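/- A cell of $\mathbb{Z}^2$ is a unit square with corners in $\mathbb{Z}^2$, and a polyomino is a non-empty finite set of cells, any two of which are joined by a path of cells of the set in which consecutive cells share an edge. For a finite set $\mathcal{P}$ of cells let $V(\mathcal{P})$ be the set of corners of its cells, let $K$ be a field, $S_{\mathcal{P}}=K[x_v : v\in V(\mathcal{P})]$, and let $I_{\mathcal{P}}\subseteq S_{\mathcal{P}}$ be the ideal generated by all binomials $x_ax_b-x_cx_d$, where $a,b$ are the diagonal and $c,d$ the anti-diagonal corners of a rectangle $[a,b]$ with $a=(i,j)$, $b=(k,l)$, $i<k$, $j<l$, all of whose cells belong to $\mathcal{P}$. Put $K[\mathcal{P}]=S_{\mathcal{P}}/I_{\mathcal{P}}$ and $\mathrm{HP}_{K[\mathcal{P}]}(t)=\sum_{k\ge 0}\dim_K (K[\mathcal{P}])_k\,t^k$, with respect to the standard grading. Let $r,s\ge 2$, let $A$ be a cell, let $A_1,\dots,A_r$ be the $r$ consecutive cells to the right of $A$ in its row, and let $B_1,\dots,B_s$ be the $s$ consecutive cells above $A$ in its column. Put $[A,A_r]=\{A,A_1,\dots,A_r\}$, $[A,B_s]=\{A,B_1,\dots,B_s\}$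 and $\mathcal{L}=[A,A_r]\cup[A,B_s]$. Let $d_i$ and $a_i$ be the upper left and upper right corners of $B_i$, and let $b_j$ and $c_j$ be the upper right and lower right corners of $A_j$. Let $\mathcal{C}$ be a polyomino. A polyomino $\mathcal{P}$ is called an $(\mathcal{L},\mathcal{C})$-polyomino if $\mathcal{P}$ is the disjoint union of $\mathcal{L}$ and $\mathcal{C}$ and $V(\mathcal{L})\cap V(\mathcal{C})$ is one (and only one) of the sets $$\{a_{s-1},a_s,b_{r-1},b_r\},\quad \{a_{s-1},a_s,c_{r-1},c_r\},\quad \{d_{s-1},d_s,b_{r-1},b_r\},\quad \{d_{s-1},d_s,c_{r-1},c_r\}.$$ Put $\mathcal{P}_1=\mathcal{P}\setminus[A,A_r]$, $\mathcal{P}_2=\mathcal{P}\setminus[A,B_s]$, $\mathcal{P}_3=\mathcal{P}\setminus([A,A_r]\cup[A,B_s])=\mathcal{C}$ and $\mathcal{P}_4=\mathcal{P}\setminus\{A,A_1,B_1\}$. Theorem. Let $\mathcal{P}$ be an $(\mathcal{L},\mathcal{C})$-polyomino such that $I_{\mathcal{P}}$ is prime. Then $$\mathrm{HP}_{K[\mathcal{P}]}(t)=\frac{1}{1-t}\,\mathrm{HP}_{K[\mathcal{P}_4]}(t)+\frac{t}{1-t}\left[\frac{\mathrm{HP}_{K[\mathcal{P}_1]}(t)}{(1-t)^{r-2}}+\frac{\mathrm{HP}_{K[\mathcal{P}_2]}(t)}{(1-t)^{s-2}}+\frac{\mathrm{HP}_{K[\mathcal{P}_3]}(t)}{(1-t)^{r+s-3}}\right].$$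 -/

import Mathlib

namespace Polyomino

/-- A cell `[v, v + (1,1)]` of `ℤ²` is encoded by its lower left corner `v`. -/
abbrev Cell := ℤ × ℤ

/-! The four corners of a cell. -/

def lowerLeft (C : Cell) : ℤ × ℤ := C

def lowerRight (C : Cell) : ℤ × ℤ := C + (1, 0)

def upperLeft (C : Cell) : ℤ × ℤ := C + (0, 1)

def upperRight (C : Cell) : ℤ × ℤ := C + (1, 1)

/-- The vertex set `V(C)` of a cell. -/
def cellVertices (C : Cell) : Finset (ℤ × ℤ) :=
  {lowerLeft C, lowerRight C, upperLeft C, upperRight C}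

/-- The edge set `E(C)` of a cell. -/
def cellEdges (C : Cell) : Finset (Finset (ℤ × ℤ)) :=
  {{lowerLeft C, upperLeft C}, {upperLeft C, upperRight C},
    {upperRight C, lowerRight C}, {lowerLeft C, lowerRight C}}

/-- The graph on all cells of `ℤ²` in which two distinct cells are adjacent when they meet in a
common edge. Its walks are the walks of cells. -/
def cellGraph : SimpleGraph Cell where
  Adj C D := C ≠ D ∧ cellVertices C ∩ cellVertices D ∈ cellEdges C ∧
    cellVertices C ∩ cellVertices D ∈ cellEdges D
  symm := ⟨fun C D h => ⟨h.1.symm, by rw [Finset.inter_comm]; exact h.2.2,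
    by rw [Finset.inter_comm]; exact h.2.1⟩⟩
  loopless := ⟨fun _ h => h.1 rfl⟩

/-- A polyomino is a non-empty finite collection of cells, any two of which are connected by a path
of cells of the collection (`SimpleGraph.Connected` includes non-emptiness). -/
def IsPolyomino (P : Finset Cell) : Prop :=
  (cellGraph.induce (P : Set Cell)).Connected

/-- The vertex set `V(P)` of a collection of cells. -/
def vertexSet (P : Finset Cell) : Finset (ℤ × ℤ) :=
  P.biUnion cellVertices

/-- `[a, b]` is an inner interval of `P`: it is a proper interval and all its cells belong to
`P`. -/
def IsInnerInterval (P : Finset Cell) (a b : ℤ × ℤ) : Prop :=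
  a.1 < b.1 ∧ a.2 < b.2 ∧
    ∀ C : Cell, a.1 ≤ C.1 → C.1 < b.1 → a.2 ≤ C.2 → C.2 < b.2 → C ∈ P

/-- All four corners of an inner interval of `P` are vertices of `P`. -/
theorem IsInnerInterval.corners_mem {P : Finset Cell} {a b : ℤ × ℤ} (h : IsInnerInterval P a b) :
    a ∈ vertexSet P ∧ b ∈ vertexSet P ∧ (a.1, b.2) ∈ vertexSet P ∧ (b.1, a.2) ∈ vertexSet P := by
  obtain ⟨h1, h2, h3⟩ := h
  simp only [vertexSet, Finset.mem_biUnion, cellVertices, lowerLeft, lowerRight, upperLeft,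
    upperRight, Finset.mem_insert, Finset.mem_singleton, Prod.ext_iff, Prod.fst_add, Prod.snd_add]
  exact ⟨⟨(a.1, a.2), h3 _ le_rfl h1 le_rfl h2, by simp⟩,
    ⟨(b.1 - 1, b.2 - 1), h3 _ (by simp; lia) (by simp) (by simp; lia) (by simp), by simp⟩,
    ⟨(a.1, b.2 - 1), h3 _ (by simp) (by simpa using h1) (by simp; lia) (by simp), by simp⟩,
    ⟨(b.1 - 1, a.2), h3 _ (by simp; lia) (by simp) (by simp) (by simpa using h2), by simp⟩⟩

/-- The polyomino ideal `I_P` in `S_P = K[x_v | v ∈ V(P)]`, generated by the inner 2-minors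
`x_a x_b - x_c x_d`, where `a, b` are the diagonal corners and `c, d` the anti-diagonal corners of
an inner interval of `P`. -/
noncomputable def polyominoIdeal (K : Type*) [Field K] (P : Finset Cell) :
    Ideal (MvPolynomial (vertexSet P) K) :=
  Ideal.span {f | ∃ a b c d : vertexSet P, IsInnerInterval P a b ∧
    (c : ℤ × ℤ) = ((a : ℤ × ℤ).1, (b : ℤ × ℤ).2) ∧ (d : ℤ × ℤ) = ((b : ℤ × ℤ).1, (a : ℤ × ℤ).2) ∧
    f = MvPolynomial.X a * MvPolynomial.X b - MvPolynomial.X c * MvPolynomial.X d}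

/-- The Hilbert function `k ↦ dim_K (R/I)_k` of `R/I`, for a (homogeneous) ideal `I` of a standard
graded polynomial ring `R` in finitely many variables; `(R/I)_k` is the image of `R_k` in `R/I`. -/
noncomputable def hilbertFunction {K σ : Type*} [Field K] [Finite σ]
    (I : Ideal (MvPolynomial σ K)) (k : ℕ) : ℕ :=
  Module.finrank K
    ((MvPolynomial.homogeneousSubmodule σ K k).map (Ideal.Quotient.mkₐ K I).toLinearMap)

/-- The Hilbert-Poincaré series `HP_{K[P]}(t)` of the coordinate ring `K[P] = S_P / I_P`. -/
noncomputable def HP (K : Type*) [Field K] (P : Finset Cell) : PowerSeries ℚ :=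
  PowerSeries.mk fun k => (hilbertFunction (polyominoIdeal K P) k : ℚ)

/-- The cell `A_j`, lying `j` steps to the right of `A`. -/
def rightCell (A : Cell) (j : ℕ) : Cell := A + ((j : ℤ), 0)

/-- The cell `B_i`, lying `i` steps above `A`. -/
def upCell (A : Cell) (i : ℕ) : Cell := A + (0, (i : ℤ))

/-- The cell interval `[A, B]`: all cells whose lower left corner lies in the integer interval
between those of `A` and `B` (in the product order of `ℤ²`). -/
noncomputable def cellInterval (A B : Cell) : Finset Cell := Finset.Icc A B

/-- The polyomino `L = [A, A_r] ∪ [A, B_s]`. -/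
noncomputable def lShape (A : Cell) (r s : ℕ) : Finset Cell :=
  cellInterval A (rightCell A r) ∪ cellInterval A (upCell A s)

/-- The four admissible values of `V(L) ∩ V(C)`. Here the upper right and upper left corners of
`B_i` are the points `a_i` and `d_i`, and the upper right and lower right corners of `A_j` are the
points `b_j` and `c_j`. -/
def junction (A : Cell) (r s : ℕ) : Fin 4 → Finset (ℤ × ℤ) :=
  ![{upperRight (upCell A (s - 1)), upperRight (upCell A s),
      upperRight (rightCell A (r - 1)), upperRight (rightCell A r)},
    {upperRight (upCell A (s - 1)), upperRight (upCell A s),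
      lowerRight (rightCell A (r - 1)), lowerRight (rightCell A r)},
    {upperLeft (upCell A (s - 1)), upperLeft (upCell A s),
      upperRight (rightCell A (r - 1)), upperRight (rightCell A r)},
    {upperLeft (upCell A (s - 1)), upperLeft (upCell A s),
      lowerRight (rightCell A (r - 1)), lowerRight (rightCell A r)}]

/-- `P` is an `(L, C)`-polyomino, where `L` is the L-shape with corner cell `A` and arms
`A_1, …, A_r` and `B_1, …, B_s`. -/
structure IsLCPolyomino (A : Cell) (r s : ℕ) (C P : Finset Cell) : Prop where
  two_le_r : 2 ≤ r
  two_le_s : 2 ≤ s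
  isPolyomino_C : IsPolyomino C
  isPolyomino : IsPolyomino P
  disjoint : Disjoint (lShape A r s) C
  eq_union : P = lShape A r s ∪ C
  junction_eq : ∃! i : Fin 4, vertexSet (lShape A r s) ∩ vertexSet C = junction A r s i

/-- `P₁ = P \ [A, A_r]`. -/
noncomputable def P₁ (A : Cell) (r : ℕ) (P : Finset Cell) : Finset Cell :=
  P \ cellInterval A (rightCell A r)

/-- `P₂ = P \ [A, B_s]`. -/
noncomputable def P₂ (A : Cell) (s : ℕ) (P : Finset Cell) : Finset Cell :=
  P \ cellInterval A (upCell A s)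

/-- `P₃ = P \ ([A, A_r] ∪ [A, B_s])`. -/
noncomputable def P₃ (A : Cell) (r s : ℕ) (P : Finset Cell) : Finset Cell :=
  P \ (cellInterval A (rightCell A r) ∪ cellInterval A (upCell A s))

/-- `P₄ = P \ {A, A_1, B_1}`. -/
def P₄ (A : Cell) (P : Finset Cell) : Finset Cell :=
  P \ {A, rightCell A 1, upCell A 1}

end Polyomino

/-!
The corner `v = (A.1 + 1 - m, A.2 + 1 - n)` of `A` lies on both edge lines `R` and `C` of the
L-shape that avoid the junction vertices, and `x_v` is a nonzerodivisor, so `K[P]` and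
`K[P] / (x_v)` differ by the factor `1 / (1 - t)`. The other corners of `A` are then added one at a
time, by `HS(I) = HS(I + (x_y)) + t HS(I : x_y)`. With `y` the second corner of `A` on `C`, then
the second one on `R`, then the remaining one, the colon ideal is `I_P` plus the variables of `R`,
of `C` and of `R ∪ C`, respectively. Each of these sets is a face: a minor with one diagonal
meeting the set has both diagonals meeting it, so that modulo the variables in the set only the
other minors are left. Those correspond to the inner minors of `P₁`, `P₂` and `P₃`, up to `r - 2`,
`s - 2` and `r + s - 3` vertices occurring in none of them. Once all corners of `A` are added, the
minors of `P₄` are left.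
-/

namespace Polyomino

open MvPolynomial

section HomogeneousIdeal

variable {R σ : Type*} [CommRing R]

attribute [local instance] MvPolynomial.gradedAlgebra

theorem homogeneousComponent_succ_X_mul (x : σ) (f : MvPolynomial σ R) (k : ℕ) :
    homogeneousComponent (k + 1) (X x * f) = X x * homogeneousComponent k f := by
  simp only [← decomposition.decompose'_apply]
  rw [add_comm]
  exact DirectSum.coe_decompose_mul_add_of_left_mem (homogeneousSubmodule σ R)
    ((mem_homogeneousSubmodule _ _).mpr (isHomogeneous_X R x))

theorem homogeneousComponent_zero_X_mul (x : σ) (f : MvPolynomial σ R) :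
    homogeneousComponent 0 (X x * f) = 0 := by
  simp [homogeneousComponent_zero, ← constantCoeff_eq]

theorem exists_sub_X_mul_mem {I : Ideal (MvPolynomial σ R)} {x : σ} {f : MvPolynomial σ R}
    (hf : f ∈ I ⊔ Ideal.span {X x}) : ∃ g, f - X x * g ∈ I := by
  obtain ⟨i, hi, j, hj, rfl⟩ := Submodule.mem_sup.mp hf
  obtain ⟨g, rfl⟩ := Ideal.mem_span_singleton.mp hj
  exact ⟨g, by simpa using hi⟩

theorem mem_of_isHomogeneous_zero_of_mem_sup_span_X {I : Ideal (MvPolynomial σ R)}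
    (hI : I.IsHomogeneous (homogeneousSubmodule σ R)) {x : σ} {f : MvPolynomial σ R}
    (hf : f.IsHomogeneous 0) (h : f ∈ I ⊔ Ideal.span {X x}) : f ∈ I := by
  obtain ⟨g, hg⟩ := exists_sub_X_mul_mem h
  simpa only [map_sub, homogeneousComponent_zero_X_mul, homogeneousComponent_eq_self hf,
    sub_zero] using homogeneousComponent_mem_of_mem hI hg 0

theorem exists_isHomogeneous_sub_X_mul_mem {I : Ideal (MvPolynomial σ R)}
    (hI : I.IsHomogeneous (homogeneousSubmodule σ R)) {x : σ} {f : MvPolynomial σ R} {k : ℕ}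
    (hf : f.IsHomogeneous (k + 1)) (h : f ∈ I ⊔ Ideal.span {X x}) :
    ∃ g : MvPolynomial σ R, g.IsHomogeneous k ∧ f - X x * g ∈ I := by
  obtain ⟨g, hg⟩ := exists_sub_X_mul_mem h
  refine ⟨homogeneousComponent k g, homogeneousComponent_isHomogeneous k g, ?_⟩
  simpa only [map_sub, homogeneousComponent_succ_X_mul, homogeneousComponent_eq_self hf] using
    homogeneousComponent_mem_of_mem hI hg (k + 1)

end HomogeneousIdeal

section FiniteDimensional

variable {K V W W' : Type*} [Field K] [AddCommGroup V] [Module K V] [AddCommGroup W] [Module K W]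
  [AddCommGroup W'] [Module K W']

theorem finrank_map_add_finrank_inf_ker (f : V →ₗ[K] W) (U : Submodule K V)
    [FiniteDimensional K U] :
    Module.finrank K (U.map f) + Module.finrank K (U ⊓ LinearMap.ker f : Submodule K V) =
      Module.finrank K U := by
  have h := (f.domRestrict U).finrank_range_add_finrank_ker
  rw [LinearMap.range_domRestrict, LinearMap.ker_domRestrict] at h
  rw [← h, ← Submodule.map_comap_subtype, Submodule.finrank_map_subtype_eq]

theorem finrank_map_eq_of_forall_mem (f : V →ₗ[K] W) (g : V →ₗ[K] W') (U : Submodule K V)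
    [FiniteDimensional K U] (h : ∀ v ∈ U, f v = 0 ↔ g v = 0) :
    Module.finrank K (U.map f) = Module.finrank K (U.map g) := by
  have hker : U ⊓ LinearMap.ker f = U ⊓ LinearMap.ker g :=
    Submodule.ext fun v => and_congr_right fun hv => h v hv
  have hf := finrank_map_add_finrank_inf_ker f U
  have hg := finrank_map_add_finrank_inf_ker g U
  rw [hker] at hf
  lia

end FiniteDimensional

section HilbertSeries

variable {K σ τ : Type*} [Field K]

attribute [local instance] MvPolynomial.gradedAlgebra

instance finiteDimensional_homogeneousSubmodule [Finite σ] (k : ℕ) :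
    FiniteDimensional K (homogeneousSubmodule σ K k) :=
  Module.Finite.iff_fg.mpr (homogeneousSubmodule_fg σ K k)

/-- The degree `k` component of the quotient `R / I` of a polynomial ring `R`, that is, the image
of `R_k` in `R / I`. -/
noncomputable def gradedPiece (I : Ideal (MvPolynomial σ K)) (k : ℕ) :
    Submodule K (MvPolynomial σ K ⧸ I) :=
  (homogeneousSubmodule σ K k).map (Ideal.Quotient.mkₐ K I).toLinearMap

theorem map_factor_gradedPiece {I J : Ideal (MvPolynomial σ K)} (h : I ≤ J) (k : ℕ) :
    (gradedPiece I k).map (Ideal.Quotient.factorₐ K h).toLinearMap = gradedPiece J k := by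
  rw [gradedPiece, ← Submodule.map_comp]
  rfl

theorem gradedPiece_succ_inf_ker_factor {I : Ideal (MvPolynomial σ K)}
    (hI : I.IsHomogeneous (homogeneousSubmodule σ K)) (x : σ) (k : ℕ) :
    gradedPiece I (k + 1) ⊓ LinearMap.ker (Ideal.Quotient.factorₐ K
        (le_sup_left : I ≤ I ⊔ Ideal.span {X x})).toLinearMap =
      (homogeneousSubmodule σ K k).map
        ((Ideal.Quotient.mkₐ K I).toLinearMap ∘ₗ LinearMap.mulLeft K (X x)) := by
  ext y
  constructor
  · rintro ⟨⟨f, hf, rfl⟩, h⟩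
    obtain ⟨g, hg, hfg⟩ :=
      exists_isHomogeneous_sub_X_mul_mem hI hf (Ideal.Quotient.eq_zero_iff_mem.mp h)
    exact ⟨g, hg, (Ideal.Quotient.eq.mpr hfg).symm⟩
  · rintro ⟨g, hg, rfl⟩
    refine ⟨⟨X x * g, ?_, rfl⟩, Ideal.Quotient.eq_zero_iff_mem.mpr (Ideal.mem_sup_right
      (Ideal.mul_mem_right _ _ (Ideal.mem_span_singleton_self _)))⟩
    rw [add_comm]
    exact (isHomogeneous_X K x).mul hg

variable [Finite σ]

instance finiteDimensional_gradedPiece (I : Ideal (MvPolynomial σ K)) (k : ℕ) :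
    FiniteDimensional K (gradedPiece I k) :=
  Module.Finite.map _ _

theorem hilbertFunction_zero_sup_span_X {I : Ideal (MvPolynomial σ K)}
    (hI : I.IsHomogeneous (homogeneousSubmodule σ K)) (x : σ) :
    hilbertFunction (I ⊔ Ideal.span {X x}) 0 = hilbertFunction I 0 := by
  refine finrank_map_eq_of_forall_mem _ _ _ fun f hf => ?_
  simp only [AlgHom.toLinearMap_apply, Ideal.Quotient.mkₐ_eq_mk, Ideal.Quotient.eq_zero_iff_mem]
  exact ⟨mem_of_isHomogeneous_zero_of_mem_sup_span_X hI hf, Ideal.mem_sup_left⟩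

theorem hilbertFunction_succ_eq_add {I L : Ideal (MvPolynomial σ K)}
    (hI : I.IsHomogeneous (homogeneousSubmodule σ K)) (x : σ) (hL : ∀ f, f ∈ L ↔ X x * f ∈ I)
    (k : ℕ) :
    hilbertFunction I (k + 1) =
      hilbertFunction (I ⊔ Ideal.span {X x}) (k + 1) + hilbertFunction L k := by
  have hcolon : hilbertFunction L k = Module.finrank K ((homogeneousSubmodule σ K k).map
      ((Ideal.Quotient.mkₐ K I).toLinearMap ∘ₗ LinearMap.mulLeft K (X x))) :=
    finrank_map_eq_of_forall_mem _ _ _ fun f _ => by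
      simp [-map_mul, Ideal.Quotient.eq_zero_iff_mem, hL]
  have hrank := finrank_map_add_finrank_inf_ker (Ideal.Quotient.factorₐ K
    (le_sup_left : I ≤ I ⊔ Ideal.span {X x})).toLinearMap (gradedPiece I (k + 1))
  rw [map_factor_gradedPiece, gradedPiece_succ_inf_ker_factor hI, ← hcolon] at hrank
  exact hrank.symm

/-- The Hilbert series of the quotient of a polynomial ring by a homogeneous ideal. -/
noncomputable def hilbertSeries (I : Ideal (MvPolynomial σ K)) : PowerSeries ℚ :=
  PowerSeries.mk fun k => (hilbertFunction I k : ℚ)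

theorem hilbertSeries_eq_add_X_mul_colon {I L : Ideal (MvPolynomial σ K)}
    (hI : I.IsHomogeneous (homogeneousSubmodule σ K)) (x : σ) (hL : ∀ f, f ∈ L ↔ X x * f ∈ I) :
    hilbertSeries I =
      hilbertSeries (I ⊔ Ideal.span {X x}) + PowerSeries.X * hilbertSeries L := by
  ext k
  cases k with
  | zero => simp [hilbertSeries, hilbertFunction_zero_sup_span_X hI]
  | succ k => simp [hilbertSeries, hilbertFunction_succ_eq_add hI x hL,
      PowerSeries.coeff_succ_X_mul]

theorem hilbertSeries_eq_inv_one_sub_X_mul {I : Ideal (MvPolynomial σ K)}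
    (hI : I.IsHomogeneous (homogeneousSubmodule σ K)) {x : σ} (hx : ∀ f, X x * f ∈ I → f ∈ I) :
    hilbertSeries I = (1 - PowerSeries.X)⁻¹ * hilbertSeries (I ⊔ Ideal.span {X x}) := by
  have h := hilbertSeries_eq_add_X_mul_colon hI x (L := I)
    fun f => ⟨I.mul_mem_left _, hx f⟩
  rw [mul_comm, PowerSeries.eq_mul_inv_iff_mul_eq (by simp)]
  linear_combination h

variable [Finite τ]

theorem hilbertSeries_eq_of_mem_iff {I : Ideal (MvPolynomial σ K)}
    {J : Ideal (MvPolynomial τ K)}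
    (φ : MvPolynomial σ K →ₐ[K] MvPolynomial τ K) (ψ : MvPolynomial τ K →ₐ[K] MvPolynomial σ K)
    (hφ : ∀ f k, f.IsHomogeneous k → (φ f).IsHomogeneous k)
    (hψ : ∀ f k, f.IsHomogeneous k → (ψ f).IsHomogeneous k)
    (hφψ : ∀ f, φ (ψ f) = f) (hIJ : ∀ f, f ∈ I ↔ φ f ∈ J) :
    hilbertSeries I = hilbertSeries J := by
  have hmap (k : ℕ) :
      (homogeneousSubmodule σ K k).map φ.toLinearMap = homogeneousSubmodule τ K k := by
    ext f
    exact ⟨fun ⟨g, hg, h⟩ => h ▸ hφ g k hg, fun h => ⟨ψ f, hψ f k h, hφψ f⟩⟩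
  ext k
  simp only [hilbertSeries, PowerSeries.coeff_mk, Nat.cast_inj]
  rw [hilbertFunction, hilbertFunction, ← hmap, ← Submodule.map_comp]
  refine finrank_map_eq_of_forall_mem _ _ _ fun f _ => ?_
  simp [Ideal.Quotient.eq_zero_iff_mem, hIJ]

end HilbertSeries

section BinomialIdeal

variable {R σ τ : Type*} [CommRing R] {G : σ → σ → σ → σ → Prop} {Y Z : Set σ}

/-- The ideal generated by the binomials `x_a x_b - x_c x_d` with `G a b c d` and by the variables
in `Z`. Adjoining variables to the ideal of a set of binomials thus only enlarges `Z`. -/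
noncomputable def binomialIdeal (R : Type*) [CommRing R] (G : σ → σ → σ → σ → Prop) (Z : Set σ) :
    Ideal (MvPolynomial σ R) :=
  Ideal.span ({f | ∃ a b c d, G a b c d ∧ f = X a * X b - X c * X d} ∪ X '' Z)

/-- `Z` is a face of the set `G` of binomials `x_a x_b - x_c x_d` if each of them keeps both or
none of its monomials when the variables in `Z` are set to zero. -/
def IsFace (G : σ → σ → σ → σ → Prop) (Z : Set σ) : Prop :=
  ∀ a b c d, G a b c d → (a ∈ Z ∨ b ∈ Z ↔ c ∈ Z ∨ d ∈ Z)

theorem IsFace.union (hZ : IsFace G Z) (hY : IsFace G Y) : IsFace G (Z ∪ Y) := by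
  intro a b c d h
  have hZ := hZ a b c d h
  have hY := hY a b c d h
  grind

theorem binomial_mem_binomialIdeal {a b c d : σ} (h : G a b c d) :
    X a * X b - X c * X d ∈ binomialIdeal R G Z :=
  Ideal.subset_span (Or.inl ⟨a, b, c, d, h, rfl⟩)

theorem X_mem_binomialIdeal {z : σ} (h : z ∈ Z) : X z ∈ binomialIdeal R G Z :=
  Ideal.subset_span (Or.inr ⟨z, h, rfl⟩)

theorem binomialIdeal_mono (h : Z ⊆ Y) : binomialIdeal R G Z ≤ binomialIdeal R G Y :=
  Ideal.span_mono (Set.union_subset_union_right _ (Set.image_mono h))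

theorem binomialIdeal_le_iff {I : Ideal (MvPolynomial σ R)} :
    binomialIdeal R G Z ≤ I ↔
      (∀ a b c d, G a b c d → X a * X b - X c * X d ∈ I) ∧ ∀ z ∈ Z, X z ∈ I := by
  rw [binomialIdeal, Ideal.span_le, Set.union_subset_iff, Set.image_subset_iff]
  refine and_congr_left fun _ => ⟨fun h a b c d hG => h ⟨a, b, c, d, hG, rfl⟩, ?_⟩
  rintro h _ ⟨a, b, c, d, hG, rfl⟩
  exact h a b c d hG

theorem binomialIdeal_insert (y : σ) :
    binomialIdeal R G (insert y Z) = binomialIdeal R G Z ⊔ Ideal.span {X y} := by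
  rw [binomialIdeal, binomialIdeal, ← Ideal.span_union, Set.image_insert_eq, Set.union_assoc,
    Set.union_singleton]

attribute [local instance] MvPolynomial.gradedAlgebra

theorem isHomogeneous_binomialIdeal :
    (binomialIdeal R G Z).IsHomogeneous (homogeneousSubmodule σ R) := by
  refine Ideal.homogeneous_span _ _ ?_
  rintro _ (⟨a, b, c, d, -, rfl⟩ | ⟨z, -, rfl⟩)
  · exact ⟨2, ((isHomogeneous_X R a).mul (isHomogeneous_X R b)).sub
      ((isHomogeneous_X R c).mul (isHomogeneous_X R d))⟩
  · exact ⟨1, isHomogeneous_X R z⟩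

theorem X_notMem_binomialIdeal [Nontrivial R] (hG : ∀ a b c d, G a b c d → a ≠ b ∧ c ≠ d) {y : σ}
    (hy : y ∉ Z) : X y ∉ binomialIdeal R G Z := by
  classical
  let ε : MvPolynomial σ R →ₐ[R] R := aeval (Pi.single y 1)
  have hmul {u v : σ} (huv : u ≠ v) : ε (X u) * ε (X v) = 0 := by
    simp only [ε, aeval_X, Pi.single_apply]
    grind
  have hle : binomialIdeal R G Z ≤ RingHom.ker ε := by
    refine binomialIdeal_le_iff.mpr ⟨fun a b c d h => ?_, fun z hz => ?_⟩
    · rw [RingHom.mem_ker, map_sub, map_mul, map_mul, hmul (hG a b c d h).1, hmul (hG a b c d h).2,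
        sub_zero]
    · simpa [RingHom.mem_ker, ε, Pi.single_apply] using fun h : z = y => hy (h ▸ hz)
  intro h
  simpa [RingHom.mem_ker, ε] using hle h

theorem IsFace.binomialIdeal_le_comap (hZ : IsFace G Z) {J : Ideal (MvPolynomial τ R)}
    (θ : MvPolynomial σ R →ₐ[R] MvPolynomial τ R) (hθ : ∀ z ∈ Z, θ (X z) = 0)
    (hJ : ∀ a b c d, G a b c d → a ∉ Z → b ∉ Z → c ∉ Z → d ∉ Z →
      θ (X a) * θ (X b) - θ (X c) * θ (X d) ∈ J) :
    binomialIdeal R G Z ≤ J.comap θ := by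
  refine binomialIdeal_le_iff.mpr ⟨fun a b c d h => ?_, fun z hz => ?_⟩
  · have hmul {u v : σ} (huv : u ∈ Z ∨ v ∈ Z) : θ (X u) * θ (X v) = 0 := by
      rcases huv with h | h <;> simp [hθ _ h]
    rw [Ideal.mem_comap, map_sub, map_mul, map_mul]
    by_cases hab : a ∈ Z ∨ b ∈ Z
    · simp [hmul hab, hmul ((hZ a b c d h).mp hab)]
    · have hcd : ¬(c ∈ Z ∨ d ∈ Z) := hab ∘ (hZ a b c d h).mpr
      push Not at hab hcd
      exact hJ a b c d h hab.1 hab.2 hcd.1 hcd.2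
  · simp [hθ z hz]

theorem mem_iff_apply_mem_of_le_comap {I : Ideal (MvPolynomial σ R)}
    {J : Ideal (MvPolynomial τ R)} (φ : MvPolynomial σ R →ₐ[R] MvPolynomial τ R)
    (ψ : MvPolynomial τ R →ₐ[R] MvPolynomial σ R) (hφ : I ≤ J.comap φ) (hψ : J ≤ I.comap ψ)
    (hψφ : ∀ z, X z - ψ (φ (X z)) ∈ I) (f : MvPolynomial σ R) : f ∈ I ↔ φ f ∈ J := by
  refine ⟨fun h => hφ h, fun h => ?_⟩
  have hmk : Ideal.Quotient.mkₐ R I = (Ideal.Quotient.mkₐ R I).comp (ψ.comp φ) :=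
    algHom_ext fun z => Ideal.Quotient.eq.mpr (hψφ z)
  have hf : f - ψ (φ f) ∈ I := Ideal.Quotient.eq.mp (DFunLike.congr_fun hmk f)
  exact (I.sub_mem_iff_left (hψ h)).mp hf

theorem IsFace.mem_binomialIdeal_iff (hZ : IsFace G Z) (f : MvPolynomial σ R) :
    f ∈ binomialIdeal R G Z ↔ aeval (Zᶜ.indicator X) f ∈ binomialIdeal R G ∅ := by
  have hmem {z : σ} (hz : z ∈ Z) :
      aeval (R := R) (Zᶜ.indicator X) (X z) = (0 : MvPolynomial σ R) := by
    simp [hz]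
  have hnotMem {z : σ} (hz : z ∉ Z) :
      aeval (R := R) (Zᶜ.indicator X) (X z) = (X z : MvPolynomial σ R) := by
    simp [hz]
  refine mem_iff_apply_mem_of_le_comap _ (AlgHom.id R _)
    (hZ.binomialIdeal_le_comap _ (fun z => hmem) fun a b c d h ha hb hc hd => ?_)
    (binomialIdeal_mono (Set.empty_subset Z)) (fun z => ?_) f
  · rw [hnotMem ha, hnotMem hb, hnotMem hc, hnotMem hd]
    exact binomial_mem_binomialIdeal h
  · by_cases hz : z ∈ Z
    · rw [hmem hz, map_zero, sub_zero]
      exact X_mem_binomialIdeal hz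
    · rw [hnotMem hz, AlgHom.id_apply, sub_self]
      exact Ideal.zero_mem _

theorem IsFace.mem_of_X_mul_mem (hZ : IsFace G Z) {y : σ} (hy : y ∉ Z)
    (hreg : ∀ f, X y * f ∈ binomialIdeal R G ∅ → f ∈ binomialIdeal R G ∅) {f : MvPolynomial σ R}
    (hf : X y * f ∈ binomialIdeal R G Z) : f ∈ binomialIdeal R G Z := by
  rw [hZ.mem_binomialIdeal_iff] at hf ⊢
  rw [map_mul, aeval_X, Set.indicator_of_mem hy] at hf
  exact hreg _ hf

theorem IsFace.mem_binomialIdeal_iff_X_mul_mem (hZ : IsFace G Z) (hYZ : Y ⊆ Z) {y : σ}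
    (hy : y ∉ Z) (hmul : ∀ z ∈ Z, X y * X z ∈ binomialIdeal R G Y)
    (hreg : ∀ f, X y * f ∈ binomialIdeal R G ∅ → f ∈ binomialIdeal R G ∅) (f : MvPolynomial σ R) :
    f ∈ binomialIdeal R G Z ↔ X y * f ∈ binomialIdeal R G Y := by
  refine ⟨fun hf => ?_, fun hf => hZ.mem_of_X_mul_mem hy hreg (binomialIdeal_mono hYZ hf)⟩
  have hle : binomialIdeal R G Z ≤ (binomialIdeal R G Y).colon {X y} := by
    refine binomialIdeal_le_iff.mpr ⟨fun a b c d h => ?_, fun z hz => ?_⟩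
    · rw [Submodule.mem_colon_singleton]
      exact Ideal.mul_mem_right _ _ (binomial_mem_binomialIdeal h)
    · rw [Submodule.mem_colon_singleton, smul_eq_mul, mul_comm]
      exact hmul z hz
  have := Submodule.mem_colon_singleton.mp (hle hf)
  rwa [smul_eq_mul, mul_comm] at this

theorem mul_X_divMonomial_single {y a : σ} (h : a ≠ y) (f : MvPolynomial σ R) :
    (f * X a).divMonomial (Finsupp.single y 1) = f.divMonomial (Finsupp.single y 1) * X a := by
  classical
  ext m
  have hsub : a ∈ m.support →
      Finsupp.single y 1 + m - Finsupp.single a 1 = Finsupp.single y 1 + (m - Finsupp.single a 1) :=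
    fun ha => add_tsub_assoc_of_le
      (Finsupp.single_le_iff.mpr (Nat.one_le_iff_ne_zero.mpr (Finsupp.mem_support_iff.mp ha))) _
  simp only [coeff_divMonomial, coeff_mul_X']
  by_cases ha : a ∈ m.support
  · rw [if_pos ha, if_pos, hsub ha]
    simpa [h] using ha
  · rw [if_neg ha, if_neg]
    simpa [h] using ha

theorem sub_divMonomial (f g : MvPolynomial σ R) (m : σ →₀ ℕ) :
    (f - g).divMonomial m = f.divMonomial m - g.divMonomial m :=
  eq_sub_of_add_eq (by rw [← add_divMonomial, sub_add_cancel])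

theorem mul_X_divMonomial_single_mem {y z : σ} (hy : y ∉ Z) (hz : z ∈ Z) (f : MvPolynomial σ R) :
    (f * X z).divMonomial (Finsupp.single y 1) ∈ binomialIdeal R G Z := by
  rw [mul_X_divMonomial_single fun hzy : z = y => hy (hzy ▸ hz)]
  exact Ideal.mul_mem_left _ _ (X_mem_binomialIdeal hz)

theorem mul_binomial_divMonomial_single_mem {y a b c d : σ} (hy : y ∉ Z) (h : G a b c d)
    (hfree : y = a ∨ y = b ∨ y = c ∨ y = d → (a ∈ Z ∨ b ∈ Z) ∧ (c ∈ Z ∨ d ∈ Z))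
    (f : MvPolynomial σ R) :
    (f * (X a * X b - X c * X d)).divMonomial (Finsupp.single y 1) ∈ binomialIdeal R G Z := by
  rw [mul_sub, sub_divMonomial]
  by_cases hG : y = a ∨ y = b ∨ y = c ∨ y = d
  · have hmonomial {u v : σ} (huv : u ∈ Z ∨ v ∈ Z) :
        (f * (X u * X v)).divMonomial (Finsupp.single y 1) ∈ binomialIdeal R G Z := by
      rcases huv with hu | hv
      · rw [mul_comm (X u), ← mul_assoc]
        exact mul_X_divMonomial_single_mem hy hu _
      · rw [← mul_assoc]
        exact mul_X_divMonomial_single_mem hy hv _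
    exact sub_mem (hmonomial (hfree hG).1) (hmonomial (hfree hG).2)
  · push Not at hG
    obtain ⟨ha, hb, hc, hd⟩ := hG
    simp only [← mul_assoc, mul_X_divMonomial_single, ha.symm, hb.symm, hc.symm, hd.symm, ne_eq,
      not_false_eq_true]
    simp only [mul_assoc, ← mul_sub]
    exact Ideal.mul_mem_left _ _ (binomial_mem_binomialIdeal h)

theorem mul_divMonomial_single_mem {y : σ} (hy : y ∉ Z)
    (hfree : ∀ a b c d, G a b c d → y = a ∨ y = b ∨ y = c ∨ y = d →
      (a ∈ Z ∨ b ∈ Z) ∧ (c ∈ Z ∨ d ∈ Z))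
    {f : MvPolynomial σ R} (hf : f ∈ binomialIdeal R G Z) (g : MvPolynomial σ R) :
    (g * f).divMonomial (Finsupp.single y 1) ∈ binomialIdeal R G Z := by
  induction hf using Submodule.span_induction generalizing g with
  | mem f hf =>
    obtain ⟨a, b, c, d, h, rfl⟩ | ⟨z, hz, rfl⟩ := hf
    · exact mul_binomial_divMonomial_single_mem hy h (hfree a b c d h) g
    · exact mul_X_divMonomial_single_mem hy hz g
  | zero => simp
  | add f₁ f₂ _ _ h₁ h₂ =>
    rw [mul_add, add_divMonomial]
    exact add_mem (h₁ g) (h₂ g)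
  | smul r f _ hf =>
    rw [smul_eq_mul, ← mul_assoc]
    exact hf (g * r)

theorem mem_of_X_mul_mem_of_forall_mem {y : σ} (hy : y ∉ Z)
    (hfree : ∀ a b c d, G a b c d → y = a ∨ y = b ∨ y = c ∨ y = d →
      (a ∈ Z ∨ b ∈ Z) ∧ (c ∈ Z ∨ d ∈ Z))
    {f : MvPolynomial σ R} (hf : X y * f ∈ binomialIdeal R G Z) : f ∈ binomialIdeal R G Z := by
  simpa [X_mul_divMonomial] using mul_divMonomial_single_mem hy hfree hf 1

section Field

variable {K : Type*} [Field K] [Finite σ]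

theorem hilbertSeries_binomialIdeal_eq_pow_mul_union (F : Finset σ) (hF : ∀ y ∈ F, y ∉ Z)
    (hfree : ∀ a b c d, G a b c d → a ∈ F ∨ b ∈ F ∨ c ∈ F ∨ d ∈ F →
      (a ∈ Z ∨ b ∈ Z) ∧ (c ∈ Z ∨ d ∈ Z)) :
    hilbertSeries (binomialIdeal K G Z) =
      ((1 - PowerSeries.X)⁻¹) ^ F.card * hilbertSeries (binomialIdeal K G (Z ∪ F)) := by
  classical
  induction F using Finset.induction_on with
  | empty => simp
  | insert y F hyF ih =>
    have hfree' : ∀ a b c d, G a b c d → a ∈ F ∨ b ∈ F ∨ c ∈ F ∨ d ∈ F →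
        (a ∈ Z ∨ b ∈ Z) ∧ (c ∈ Z ∨ d ∈ Z) := fun a b c d h hF => hfree a b c d h (by grind)
    have hreg (f : MvPolynomial σ K) (hf : X y * f ∈ binomialIdeal K G (Z ∪ F)) :
        f ∈ binomialIdeal K G (Z ∪ F) := by
      refine mem_of_X_mul_mem_of_forall_mem (by grind) (fun a b c d h hy => ?_) hf
      have := hfree a b c d h (by grind)
      grind
    rw [ih (fun z hz => hF z (Finset.mem_insert_of_mem hz)) hfree',
      hilbertSeries_eq_inv_one_sub_X_mul isHomogeneous_binomialIdeal hreg, ← binomialIdeal_insert,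
      Finset.card_insert_of_notMem hyF, pow_succ, mul_assoc, Finset.coe_insert, Set.union_insert]

variable [Finite τ] {H : τ → τ → τ → τ → Prop} {e : τ → σ}

theorem hilbertSeries_binomialIdeal_eq_of_injective (he : Function.Injective e)
    (hZ : IsFace G (Set.range e)ᶜ) (hH : ∀ a b c d, H a b c d ↔ G (e a) (e b) (e c) (e d)) :
    hilbertSeries (binomialIdeal K G (Set.range e)ᶜ) = hilbertSeries (binomialIdeal K H ∅) := by
  let φ : MvPolynomial σ K →ₐ[K] MvPolynomial τ K := aeval (Function.extend e X 0)
  have hφ (t : τ) : φ (X (e t)) = X t := by simp [φ, he.extend_apply]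
  have hφ_zero {z : σ} (hz : z ∉ Set.range e) : φ (X z) = 0 := by
    simp only [φ, aeval_X, Function.extend_apply' _ _ _ hz, Pi.zero_apply]
  have hφ_hom (f : MvPolynomial σ K) (k : ℕ) (hf : f.IsHomogeneous k) :
      (φ f).IsHomogeneous k := by
    rw [← one_mul k]
    refine hf.aeval _ fun z => ?_
    by_cases hz : z ∈ Set.range e
    · obtain ⟨t, rfl⟩ := hz
      rw [he.extend_apply]
      exact isHomogeneous_X K t
    · rw [Function.extend_apply' _ _ _ hz]
      exact isHomogeneous_zero τ K 1
  have hφψ : φ.comp (rename e) = AlgHom.id K _ := algHom_ext fun t => by simp [hφ]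
  refine hilbertSeries_eq_of_mem_iff φ (rename e) hφ_hom (fun f k hf => hf.rename_isHomogeneous)
    (DFunLike.congr_fun hφψ) (mem_iff_apply_mem_of_le_comap φ (rename e)
      (hZ.binomialIdeal_le_comap φ (fun z => hφ_zero) ?_) ?_ fun z => ?_)
  · simp only [Set.mem_compl_iff, not_not]
    rintro _ _ _ _ h ⟨a, rfl⟩ ⟨b, rfl⟩ ⟨c, rfl⟩ ⟨d, rfl⟩
    simp only [hφ]
    exact binomial_mem_binomialIdeal ((hH a b c d).mpr h)
  · refine binomialIdeal_le_iff.mpr ⟨fun a b c d h => ?_, fun z hz => hz.elim⟩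
    simp only [Ideal.mem_comap, map_sub, map_mul, rename_X]
    exact binomial_mem_binomialIdeal ((hH a b c d).mp h)
  · by_cases hz : z ∈ Set.range e
    · obtain ⟨t, rfl⟩ := hz
      simp [hφ]
    · rw [hφ_zero hz, map_zero, sub_zero]
      exact X_mem_binomialIdeal hz

theorem IsFace.hilbertSeries_eq_pow_mul (hZ : IsFace G Z) (F : Finset σ) (hFZ : ∀ y ∈ F, y ∉ Z)
    (hfree : ∀ a b c d, G a b c d → a ∈ F ∨ b ∈ F ∨ c ∈ F ∨ d ∈ F →
      (a ∈ Z ∨ b ∈ Z) ∧ (c ∈ Z ∨ d ∈ Z))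
    (he : Function.Injective e) (hrange : ∀ z, z ∈ Set.range e ↔ z ∉ Z ∧ z ∉ F)
    (hH : ∀ a b c d, H a b c d ↔ G (e a) (e b) (e c) (e d)) :
    hilbertSeries (binomialIdeal K G Z) =
      ((1 - PowerSeries.X)⁻¹) ^ F.card * hilbertSeries (binomialIdeal K H ∅) := by
  have hcompl : Z ∪ F = (Set.range e)ᶜ := by
    ext z
    have := hrange z
    grind
  have hface : IsFace G (Set.range e)ᶜ := by
    intro a b c d h
    have := hZ a b c d h
    have := hfree a b c d h
    grind
  rw [hilbertSeries_binomialIdeal_eq_pow_mul_union F hFZ hfree, hcompl,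
    hilbertSeries_binomialIdeal_eq_of_injective he hface hH]

theorem hilbertSeries_binomialIdeal_preimage_equiv (e : σ ≃ τ) {Z : Set τ}
    (hGH : ∀ a b c d, G a b c d ↔ H (e a) (e b) (e d) (e c)) :
    hilbertSeries (binomialIdeal K G (e ⁻¹' Z)) = hilbertSeries (binomialIdeal K H Z) := by
  refine hilbertSeries_eq_of_mem_iff (rename e) (rename e.symm)
    (fun f k hf => hf.rename_isHomogeneous) (fun f k hf => hf.rename_isHomogeneous)
    (fun f => by simp [rename_rename])
    (mem_iff_apply_mem_of_le_comap (rename e) (rename e.symm) ?_ ?_ fun z => ?_)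
  · refine binomialIdeal_le_iff.mpr ⟨fun a b c d h => ?_, fun z hz => ?_⟩
    · rw [Ideal.mem_comap, mul_comm (X c), map_sub, map_mul, map_mul]
      simp only [rename_X]
      exact binomial_mem_binomialIdeal ((hGH a b c d).mp h)
    · rw [Ideal.mem_comap, rename_X]
      exact X_mem_binomialIdeal hz
  · refine binomialIdeal_le_iff.mpr ⟨fun a b c d h => ?_, fun z hz => ?_⟩
    · rw [Ideal.mem_comap, mul_comm (X c), map_sub, map_mul, map_mul]
      simp only [rename_X]
      exact binomial_mem_binomialIdeal ((hGH _ _ _ _).mpr (by simpa using h))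
    · rw [Ideal.mem_comap, rename_X]
      exact X_mem_binomialIdeal (by simpa using hz)
  · simp

end Field

end BinomialIdeal

section Minors

variable {K : Type*} [Field K] {P : Finset Cell} {Z : Set (ℤ × ℤ)} {a b c d v : ℤ × ℤ}

theorem mem_vertexSet :
    v ∈ vertexSet P ↔ ∃ D ∈ P, D.1 ≤ v.1 ∧ v.1 ≤ D.1 + 1 ∧ D.2 ≤ v.2 ∧ v.2 ≤ D.2 + 1 := by
  simp only [vertexSet, Finset.mem_biUnion, cellVertices, lowerLeft, lowerRight, upperLeft,
    upperRight, Finset.mem_insert, Finset.mem_singleton, Prod.ext_iff, Prod.fst_add, Prod.snd_add]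
  grind

theorem mem_cellVertices {D : Cell} :
    v ∈ cellVertices D ↔ D.1 ≤ v.1 ∧ v.1 ≤ D.1 + 1 ∧ D.2 ≤ v.2 ∧ v.2 ≤ D.2 + 1 := by
  simpa [vertexSet] using mem_vertexSet (P := {D}) (v := v)

/-- The cells of the possibly degenerate rectangle in which `a` and `b` are opposite corners,
diagonal or anti-diagonal. -/
noncomputable def box (a b : ℤ × ℤ) : Finset Cell :=
  Finset.Ico (min a.1 b.1) (max a.1 b.1) ×ˢ Finset.Ico (min a.2 b.2) (max a.2 b.2)

theorem mem_box {D : Cell} : D ∈ box a b ↔ (min a.1 b.1 ≤ D.1 ∧ D.1 < max a.1 b.1) ∧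
    min a.2 b.2 ≤ D.2 ∧ D.2 < max a.2 b.2 := by
  rw [box, Finset.mem_product, Finset.mem_Ico, Finset.mem_Ico]

/-- `a, b` and `c, d` are the two pairs of opposite corners of an inner interval of `P`. Unlike in
`IsInnerInterval`, either pair may be the diagonal one, in either order, so that every corner of the
interval can take the role of `a`. -/
def IsMinor (P : Finset Cell) (a b c d : ℤ × ℤ) : Prop :=
  a.1 ≠ b.1 ∧ a.2 ≠ b.2 ∧ c = (a.1, b.2) ∧ d = (b.1, a.2) ∧ box a b ⊆ P

theorem IsMinor.swap (h : IsMinor P a b c d) : IsMinor P b a d c := by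
  obtain ⟨h₁, h₂, rfl, rfl, hP⟩ := h
  refine ⟨h₁.symm, h₂.symm, rfl, rfl, ?_⟩
  rwa [box, min_comm b.1, max_comm b.1, min_comm b.2, max_comm b.2]

theorem IsMinor.flip (h : IsMinor P a b c d) : IsMinor P c d a b := by
  obtain ⟨h₁, h₂, rfl, rfl, hP⟩ := h
  refine ⟨h₁, h₂.symm, rfl, rfl, ?_⟩
  rwa [box, min_comm b.2, max_comm b.2]

theorem IsMinor.exists_mem_box (h : IsMinor P a b c d) : ∃ D ∈ box a b, a ∈ cellVertices D := by
  obtain ⟨h₁, h₂, -⟩ := h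
  refine ⟨(if a.1 < b.1 then a.1 else a.1 - 1, if a.2 < b.2 then a.2 else a.2 - 1),
    mem_box.mpr ?_, mem_cellVertices.mpr ?_⟩ <;> grind

theorem IsMinor.left_mem_vertexSet (h : IsMinor P a b c d) : a ∈ vertexSet P := by
  obtain ⟨D, hD, ha⟩ := h.exists_mem_box
  exact Finset.mem_biUnion.mpr ⟨D, h.2.2.2.2 hD, ha⟩

theorem IsMinor.mem_vertexSet (h : IsMinor P a b c d) :
    a ∈ vertexSet P ∧ b ∈ vertexSet P ∧ c ∈ vertexSet P ∧ d ∈ vertexSet P :=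
  ⟨h.left_mem_vertexSet, h.swap.left_mem_vertexSet, h.flip.left_mem_vertexSet,
    h.swap.flip.left_mem_vertexSet⟩

theorem isInnerInterval_iff_box_subset (h₁ : a.1 < b.1) (h₂ : a.2 < b.2) :
    IsInnerInterval P a b ↔ box a b ⊆ P := by
  simp only [IsInnerInterval, h₁, h₂, true_and, Finset.subset_iff, mem_box, min_eq_left h₁.le,
    max_eq_right h₁.le, min_eq_left h₂.le, max_eq_right h₂.le, and_imp]

theorem IsInnerInterval.isMinor (h : IsInnerInterval P a b) :
    IsMinor P a b (a.1, b.2) (b.1, a.2) :=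
  ⟨h.1.ne, h.2.1.ne, rfl, rfl, (isInnerInterval_iff_box_subset h.1 h.2.1).mp h⟩

theorem IsMinor.isInnerInterval (h : IsMinor P a b c d) (h₁ : a.1 < b.1) (h₂ : a.2 < b.2) :
    IsInnerInterval P a b :=
  (isInnerInterval_iff_box_subset h₁ h₂).mpr h.2.2.2.2

/-- The ideal generated by the inner 2-minors of `P` and by the variables of the vertices of `P`
lying in `Z`. -/
noncomputable def minorIdeal (K : Type*) [Field K] (P : Finset Cell) (Z : Set (ℤ × ℤ)) :
    Ideal (MvPolynomial (vertexSet P) K) :=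
  binomialIdeal K (fun a b c d : vertexSet P => IsMinor P a b c d) ((↑) ⁻¹' Z)

theorem polyominoIdeal_eq_minorIdeal : polyominoIdeal K P = minorIdeal K P ∅ := by
  apply le_antisymm
  · refine Ideal.span_le.mpr ?_
    rintro _ ⟨a, b, c, d, h, hc, hd, rfl⟩
    exact binomial_mem_binomialIdeal (G := fun a b c d : vertexSet P => IsMinor P a b c d)
      (hc ▸ hd ▸ h.isMinor)
  · have hlt (a b c d : vertexSet P) (h : IsMinor P a b c d) (h₁ : a.1.1 < b.1.1)
        (h₂ : a.1.2 < b.1.2) : X a * X b - X c * X d ∈ polyominoIdeal K P :=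
      Ideal.subset_span ⟨a, b, c, d, h.isInnerInterval h₁ h₂, h.2.2.1, h.2.2.2.1, rfl⟩
    have hlt' (a b c d : vertexSet P) (h : IsMinor P a b c d) (h₁ : a.1.1 < b.1.1) :
        X a * X b - X c * X d ∈ polyominoIdeal K P := by
      rcases lt_or_gt_of_ne h.2.1 with h₂ | h₂
      · exact hlt a b c d h h₁ h₂
      · have := hlt c d a b h.flip (by simpa [h.2.2.1, h.2.2.2.1] using h₁)
          (by simpa [h.2.2.1, h.2.2.2.1] using h₂)
        rwa [← neg_mem_iff, neg_sub]
    refine binomialIdeal_le_iff.mpr ⟨fun a b c d h => ?_, fun z hz => hz.elim⟩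
    rcases lt_or_gt_of_ne h.1 with h₁ | h₁
    · exact hlt' a b c d h h₁
    · rw [mul_comm (X a), mul_comm (X c)]
      exact hlt' b a d c h.swap h₁

theorem HP_eq_hilbertSeries : HP K P = hilbertSeries (minorIdeal K P ∅) := by
  rw [← polyominoIdeal_eq_minorIdeal]
  rfl

theorem X_notMem_polyominoIdeal (v : vertexSet P) : X v ∉ polyominoIdeal K P := by
  rw [polyominoIdeal_eq_minorIdeal]
  refine X_notMem_binomialIdeal (fun a b c d h => ⟨fun hab => ?_, fun hcd => ?_⟩)
    (Set.notMem_empty _)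
  · exact h.1 (by rw [hab])
  · exact h.flip.1 (by rw [hcd])

theorem X_mul_X_mem_minorIdeal {w z : vertexSet P} (h : box w z ⊆ P)
    (hZ : (w.1.1, z.1.2) ∈ Z ∨ (z.1.1, w.1.2) ∈ Z) : X w * X z ∈ minorIdeal K P Z := by
  have hX {u : vertexSet P} (hu : (u : ℤ × ℤ) ∈ Z) : X u ∈ minorIdeal K P Z :=
    X_mem_binomialIdeal hu
  by_cases hwz : w.1.1 = z.1.1 ∨ w.1.2 = z.1.2
  · have hmem : (w : ℤ × ℤ) ∈ Z ∨ (z : ℤ × ℤ) ∈ Z := by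
      rcases hwz with hwz | hwz <;> simp only [hwz, Prod.mk.eta] at hZ
      · rwa [or_comm, ← hwz] at hZ
      · rwa [← hwz] at hZ
    rcases hmem with hw | hz
    · exact Ideal.mul_mem_right _ _ (hX hw)
    · exact Ideal.mul_mem_left _ _ (hX hz)
  · push Not at hwz
    have hminor : IsMinor P w z (w.1.1, z.1.2) (z.1.1, w.1.2) := ⟨hwz.1, hwz.2, rfl, rfl, h⟩
    obtain ⟨-, -, hc, hd⟩ := hminor.mem_vertexSet
    have hcd : X ⟨_, hc⟩ * X ⟨_, hd⟩ ∈ minorIdeal K P Z := by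
      rcases hZ with hZ | hZ
      · exact Ideal.mul_mem_right _ _ (hX hZ)
      · exact Ideal.mul_mem_left _ _ (hX hZ)
    refine (Submodule.sub_mem_iff_left _ hcd).mp (binomial_mem_binomialIdeal ?_)
    exact hminor

theorem isFace_isMinor_Icc {x₀ x₁ y₀ y₁ : ℤ} (h₀₀ : (x₀ - 1, y₀ - 1) ∉ P)
    (h₀₁ : (x₀ - 1, y₁) ∉ P) (h₁₀ : (x₁, y₀ - 1) ∉ P) (h₁₁ : (x₁, y₁) ∉ P) :
    IsFace (IsMinor P) (Set.Icc (x₀, y₀) (x₁, y₁)) := by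
  have hcorner {a b c d : ℤ × ℤ} (h : IsMinor P a b c d)
      (ha : a ∈ Set.Icc (x₀, y₀) (x₁, y₁)) :
      c ∈ Set.Icc (x₀, y₀) (x₁, y₁) ∨ d ∈ Set.Icc (x₀, y₀) (x₁, y₁) := by
    obtain ⟨-, -, rfl, rfl, hP⟩ := h
    have hP {x y : ℤ} (hxy : (x, y) ∉ P) := mt (@hP (x, y)) hxy
    have := hP h₀₀
    have := hP h₀₁
    have := hP h₁₀
    have := hP h₁₁
    simp only [mem_box, Set.mem_Icc, Prod.le_def] at *
    grind
  refine fun a b c d h => ⟨?_, ?_⟩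
  · rintro (ha | hb)
    exacts [hcorner h ha, (hcorner h.swap hb).symm]
  · rintro (hc | hd)
    exacts [hcorner h.flip hc, (hcorner h.flip.swap hd).symm]

end Minors

section HilbertSeriesMinors

variable {K : Type*} [Field K] {P Q : Finset Cell} {Y Z : Set (ℤ × ℤ)}

attribute [local instance] MvPolynomial.gradedAlgebra

theorem minorIdeal_insert (y : vertexSet P) :
    minorIdeal K P (insert (y : ℤ × ℤ) Y) = minorIdeal K P Y ⊔ Ideal.span {X y} := by
  rw [minorIdeal, minorIdeal, ← binomialIdeal_insert]
  exact congrArg _ (Set.ext fun v => or_congr_left Subtype.ext_iff.symm)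

theorem isHomogeneous_minorIdeal :
    (minorIdeal K P Z).IsHomogeneous (homogeneousSubmodule (vertexSet P) K) :=
  isHomogeneous_binomialIdeal

theorem hilbertSeries_minorIdeal_empty (y : vertexSet P)
    (hy : ∀ f, X y * f ∈ minorIdeal K P ∅ → f ∈ minorIdeal K P ∅) :
    hilbertSeries (minorIdeal K P ∅) =
      (1 - PowerSeries.X)⁻¹ * hilbertSeries (minorIdeal K P {(y : ℤ × ℤ)}) := by
  rw [hilbertSeries_eq_inv_one_sub_X_mul isHomogeneous_minorIdeal hy, ← minorIdeal_insert,
    LawfulSingleton.insert_empty_eq]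

theorem IsFace.hilbertSeries_minorIdeal (hZ : IsFace (IsMinor P) Z) (hYZ : Y ⊆ Z)
    (y : vertexSet P) (hyZ : (y : ℤ × ℤ) ∉ Z)
    (hmul : ∀ z : vertexSet P, (z : ℤ × ℤ) ∈ Z → X y * X z ∈ minorIdeal K P Y)
    (hreg : ∀ f, X y * f ∈ minorIdeal K P ∅ → f ∈ minorIdeal K P ∅) :
    hilbertSeries (minorIdeal K P Y) = hilbertSeries (minorIdeal K P (insert (y : ℤ × ℤ) Y)) +
      PowerSeries.X * hilbertSeries (minorIdeal K P Z) := by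
  have hZ' : IsFace (fun a b c d : vertexSet P => IsMinor P a b c d) ((↑) ⁻¹' Z) :=
    fun a b c d => hZ a b c d
  rw [minorIdeal_insert]
  exact hilbertSeries_eq_add_X_mul_colon isHomogeneous_minorIdeal y
    (hZ'.mem_binomialIdeal_iff_X_mul_mem (Set.preimage_mono hYZ) hyZ hmul hreg)

theorem IsFace.hilbertSeries_minorIdeal_eq_pow_mul_HP (hZ : IsFace (IsMinor P) Z)
    {F : Finset (ℤ × ℤ)} (hFP : F ⊆ vertexSet P) (hFZ : ∀ v ∈ F, v ∉ Z)
    (hfree : ∀ a b c d, IsMinor P a b c d → a ∉ Z → b ∉ Z → c ∉ Z → d ∉ Z → a ∉ F)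
    {e : ℤ × ℤ → ℤ × ℤ} (he : Set.InjOn e (vertexSet Q))
    (hrange : e '' vertexSet Q = (vertexSet P : Set (ℤ × ℤ)) \ (Z ∪ F))
    (hminor : ∀ a ∈ vertexSet Q, ∀ b ∈ vertexSet Q, ∀ c ∈ vertexSet Q, ∀ d ∈ vertexSet Q,
      IsMinor Q a b c d ↔ IsMinor P (e a) (e b) (e c) (e d)) :
    hilbertSeries (minorIdeal K P Z) =
      ((1 - PowerSeries.X)⁻¹) ^ F.card * HP K Q := by
  have hmem {v : ℤ × ℤ} : v ∈ e '' vertexSet Q ↔ v ∈ vertexSet P ∧ v ∉ Z ∧ v ∉ F := by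
    simp only [hrange, Set.mem_sdiff, Set.mem_union, SetLike.mem_coe, not_or]
  let e' : vertexSet Q → vertexSet P := fun v => ⟨e v, (hmem.mp ⟨v, v.2, rfl⟩).1⟩
  have he' : Function.Injective e' := fun v w h => Subtype.ext (he v.2 w.2 (congrArg Subtype.val h))
  have hZ' : IsFace (fun a b c d : vertexSet P => IsMinor P a b c d) ((↑) ⁻¹' Z) :=
    fun a b c d => hZ a b c d
  have hfree' (a b c d : ℤ × ℤ) (h : IsMinor P a b c d) (ha : a ∈ F) :
      (a ∈ Z ∨ b ∈ Z) ∧ (c ∈ Z ∨ d ∈ Z) := by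
    have := hZ a b c d h
    have := hfree a b c d h
    grind
  have hcard : (F.subtype (· ∈ vertexSet P)).card = F.card := by
    rw [Finset.card_subtype, Finset.filter_true_of_mem fun v hv => hFP hv]
  rw [HP_eq_hilbertSeries, minorIdeal, minorIdeal, Set.preimage_empty, ← hcard]
  refine hZ'.hilbertSeries_eq_pow_mul _ (fun v hv => hFZ v (Finset.mem_subtype.mp hv))
    (fun a b c d h hF => ?_) he' (fun v => ?_) fun a b c d => hminor a a.2 b b.2 c c.2 d d.2
  · simp only [Finset.mem_subtype] at hF
    rcases hF with ha | hb | hc | hd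
    · exact hfree' _ _ _ _ h ha
    · exact (hfree' _ _ _ _ h.swap hb).imp Or.symm Or.symm
    · exact (hfree' _ _ _ _ h.flip hc).symm
    · exact (hfree' _ _ _ _ h.flip.swap hd).symm.imp Or.symm Or.symm
  · rw [Finset.mem_subtype, Set.mem_preimage, ← (hmem.trans (and_iff_right v.2))]
    exact ⟨fun ⟨w, hw⟩ => ⟨w, w.2, congrArg Subtype.val hw⟩,
      fun ⟨w, hw, hv⟩ => ⟨⟨w, hw⟩, Subtype.ext hv⟩⟩

end HilbertSeriesMinors

section Transpose

variable {K : Type*} [Field K] {P : Finset Cell}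

/-- The reflection of a set of points or cells of `ℤ²` in the main diagonal. -/
def transpose (S : Finset (ℤ × ℤ)) : Finset (ℤ × ℤ) :=
  S.map (Equiv.prodComm ℤ ℤ).toEmbedding

theorem mem_transpose {S : Finset (ℤ × ℤ)} {v : ℤ × ℤ} : v ∈ transpose S ↔ v.swap ∈ S :=
  Finset.mem_map_equiv

theorem vertexSet_transpose : vertexSet (transpose P) = transpose (vertexSet P) := by
  ext v
  simp only [mem_transpose, mem_vertexSet, Prod.fst_swap, Prod.snd_swap]
  exact ⟨fun ⟨D, hD, h₁, h₂, h₃, h₄⟩ => ⟨D.swap, hD, h₃, h₄, h₁, h₂⟩,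
    fun ⟨D, hD, h₁, h₂, h₃, h₄⟩ => ⟨D.swap, D.swap_swap.symm ▸ hD, h₃, h₄, h₁, h₂⟩⟩

theorem isMinor_transpose {a b c d : ℤ × ℤ} :
    IsMinor (transpose P) a b c d ↔ IsMinor P a.swap b.swap d.swap c.swap := by
  have hbox : box a b ⊆ transpose P ↔ box a.swap b.swap ⊆ P := by
    refine ⟨fun h D hD => ?_, fun h D hD => mem_transpose.mpr (h (mem_box.mpr ?_))⟩
    · exact mem_transpose.mp (h (mem_box.mpr (mem_box.mp hD).symm) : D.swap ∈ transpose P)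
    · exact (mem_box.mp hD).symm
  simp only [IsMinor, hbox, Prod.fst_swap, Prod.snd_swap]
  grind

theorem hilbertSeries_minorIdeal_transpose (Z : Set (ℤ × ℤ)) :
    hilbertSeries (minorIdeal K (transpose P) Z) =
      hilbertSeries (minorIdeal K P (Prod.swap ⁻¹' Z)) := by
  let e : vertexSet (transpose P) ≃ vertexSet P := (Equiv.prodComm ℤ ℤ).subtypeEquiv fun v => by
    rw [vertexSet_transpose, mem_transpose]
    rfl
  have he (v : vertexSet (transpose P)) : (e v : ℤ × ℤ) = (v : ℤ × ℤ).swap := rfl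
  have hZ : (e ⁻¹' ((↑) ⁻¹' (Prod.swap ⁻¹' Z)) : Set (vertexSet (transpose P))) = (↑) ⁻¹' Z := by
    ext v
    simp only [Set.mem_preimage, he, Prod.swap_swap]
  rw [minorIdeal, minorIdeal, ← hZ]
  refine hilbertSeries_binomialIdeal_preimage_equiv e fun a b c d => ?_
  simp only [he, isMinor_transpose]

theorem HP_transpose : HP K (transpose P) = HP K P :=
  HP_eq_hilbertSeries.trans ((hilbertSeries_minorIdeal_transpose ∅).trans HP_eq_hilbertSeries.symm)

end Transpose

section LShape

variable {A D : Cell} {r s : ℕ} {P : Finset Cell} {v : ℤ × ℤ}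

theorem mem_cellInterval_rightCell :
    D ∈ cellInterval A (rightCell A r) ↔ D.2 = A.2 ∧ A.1 ≤ D.1 ∧ D.1 ≤ A.1 + r := by
  simp only [cellInterval, rightCell, Finset.mem_Icc, Prod.le_def, Prod.fst_add, Prod.snd_add]
  grind

theorem mem_cellInterval_upCell :
    D ∈ cellInterval A (upCell A s) ↔ D.1 = A.1 ∧ A.2 ≤ D.2 ∧ D.2 ≤ A.2 + s := by
  simp only [cellInterval, upCell, Finset.mem_Icc, Prod.le_def, Prod.fst_add, Prod.snd_add]
  grind

theorem mem_lShape : D ∈ lShape A r s ↔ D.2 = A.2 ∧ A.1 ≤ D.1 ∧ D.1 ≤ A.1 + r ∨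
    D.1 = A.1 ∧ A.2 ≤ D.2 ∧ D.2 ≤ A.2 + s := by
  rw [lShape, Finset.mem_union, mem_cellInterval_rightCell, mem_cellInterval_upCell]

theorem mem_vertexSet_lShape : v ∈ vertexSet (lShape A r s) ↔
    A.2 ≤ v.2 ∧ v.2 ≤ A.2 + 1 ∧ A.1 ≤ v.1 ∧ v.1 ≤ A.1 + r + 1 ∨
      A.1 ≤ v.1 ∧ v.1 ≤ A.1 + 1 ∧ A.2 ≤ v.2 ∧ v.2 ≤ A.2 + s + 1 := by
  simp only [mem_vertexSet, mem_lShape]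
  constructor
  · grind
  · rintro (h | h)
    · exact ⟨(min v.1 (A.1 + r), A.2), by grind⟩
    · exact ⟨(A.1, min v.2 (A.2 + s)), by grind⟩

theorem transpose_lShape : transpose (lShape A r s) = lShape A.swap s r := by
  ext D
  simp only [mem_transpose, mem_lShape, Prod.fst_swap, Prod.snd_swap]
  exact or_comm

theorem exists_mem_junction_iff (hr : 1 ≤ r) (hs : 1 ≤ s) (i : Fin 4) :
    ∃ m n : ℤ, (m = 0 ∨ m = 1) ∧ (n = 0 ∨ n = 1) ∧ ∀ v ∈ vertexSet (lShape A r s),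
      v ∈ junction A r s i ↔
        v.1 = A.1 + m ∧ A.2 + s ≤ v.2 ∨ v.2 = A.2 + n ∧ A.1 + r ≤ v.1 := by
  refine ⟨![1, 1, 0, 0] i, ![1, 0, 1, 0] i, by fin_cases i <;> simp, by fin_cases i <;> simp,
    fun v hv => ?_⟩
  rw [mem_vertexSet_lShape] at hv
  fin_cases i <;>
  · simp only [junction, upperLeft, upperRight, lowerRight, upCell, rightCell, Fin.zero_eta,
      Fin.mk_one, Fin.reduceFinMk, Matrix.cons_val_zero, Matrix.cons_val_one, Matrix.cons_val,
      Finset.mem_insert, Finset.mem_singleton, Prod.ext_iff, Prod.fst_add, Prod.snd_add,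
      Nat.cast_sub, Nat.cast_one, hr, hs]
    grind

/-- `P` contains the L-shape with corner cell `A` and arms of lengths `r` and `s`, and the rest of
`P` meets it exactly in the last two vertices of each arm: those of the vertical arm on the line
`x = A.1 + m` and those of the horizontal arm on the line `y = A.2 + n`. The four choices of
`m, n ∈ {0, 1}` correspond to the four values of `junction`. -/
structure HasLHandle (A : Cell) (r s : ℕ) (m n : ℤ) (P : Finset Cell) : Prop where
  two_le_r : 2 ≤ r
  two_le_s : 2 ≤ s
  m_eq : m = 0 ∨ m = 1
  n_eq : n = 0 ∨ n = 1
  lShape_subset : lShape A r s ⊆ P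
  mem_vertexSet_sdiff_iff : ∀ v ∈ vertexSet (lShape A r s), v ∈ vertexSet (P \ lShape A r s) ↔
    v.1 = A.1 + m ∧ A.2 + s ≤ v.2 ∨ v.2 = A.2 + n ∧ A.1 + r ≤ v.1

variable {m n : ℤ}

theorem exists_hasLHandle (hr : 2 ≤ r) (hs : 2 ≤ s) (hL : lShape A r s ⊆ P) {i : Fin 4}
    (hi : vertexSet (lShape A r s) ∩ vertexSet (P \ lShape A r s) = junction A r s i) :
    ∃ m n, HasLHandle A r s m n P := by
  obtain ⟨m, n, hm, hn, h⟩ := exists_mem_junction_iff (A := A) (r := r) (s := s) (by lia) (by lia) i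
  refine ⟨m, n, hr, hs, hm, hn, hL, fun v hv => ?_⟩
  rw [← h v hv, ← hi, Finset.mem_inter, and_iff_right hv]

namespace HasLHandle

theorem transpose (h : HasLHandle A r s m n P) :
    HasLHandle A.swap s r n m (Polyomino.transpose P) where
  two_le_r := h.two_le_s
  two_le_s := h.two_le_r
  m_eq := h.n_eq
  n_eq := h.m_eq
  lShape_subset := by
    rw [← transpose_lShape]
    exact Finset.map_subset_map.mpr h.lShape_subset
  mem_vertexSet_sdiff_iff v hv := by
    have hsdiff : Polyomino.transpose P \ Polyomino.transpose (lShape A r s) =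
        Polyomino.transpose (P \ lShape A r s) := (Finset.map_sdiff _ _).symm
    rw [← transpose_lShape, vertexSet_transpose, mem_transpose] at hv
    rw [← transpose_lShape, hsdiff, vertexSet_transpose, mem_transpose,
      h.mem_vertexSet_sdiff_iff _ hv, or_comm]
    rfl

theorem mem_lShape_of_mem (h : HasLHandle A r s m n P) (hD : D ∈ P) (hv : v ∈ cellVertices D)
    (hvL : v ∈ vertexSet (lShape A r s)) (hm : v.1 = A.1 + m → v.2 < A.2 + s)
    (hn : v.2 = A.2 + n → v.1 < A.1 + r) : D ∈ lShape A r s := by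
  by_contra hDL
  have := (h.mem_vertexSet_sdiff_iff v hvL).mp
    (Finset.mem_biUnion.mpr ⟨D, Finset.mem_sdiff.mpr ⟨hD, hDL⟩, hv⟩)
  grind

end HasLHandle

end LShape

section Faces

variable {A D : Cell} {r s : ℕ} {m n : ℤ} {P : Finset Cell} {a b c d v : ℤ × ℤ}

/-- The vertices of the horizontal arm on the edge line without junction vertices. -/
def outerRow (A : Cell) (r : ℕ) (n : ℤ) : Set (ℤ × ℤ) :=
  Set.Icc (A.1, A.2 + 1 - n) (A.1 + r + 1, A.2 + 1 - n)

/-- The vertices of the vertical arm on the edge line without junction vertices. -/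
def outerCol (A : Cell) (s : ℕ) (m : ℤ) : Set (ℤ × ℤ) :=
  Set.Icc (A.1 + 1 - m, A.2) (A.1 + 1 - m, A.2 + s + 1)

theorem mem_outerRow :
    v ∈ outerRow A r n ↔ v.2 = A.2 + 1 - n ∧ A.1 ≤ v.1 ∧ v.1 ≤ A.1 + r + 1 := by
  simp only [outerRow, Set.mem_Icc, Prod.le_def]
  grind

theorem mem_outerCol :
    v ∈ outerCol A s m ↔ v.1 = A.1 + 1 - m ∧ A.2 ≤ v.2 ∧ v.2 ≤ A.2 + s + 1 := by
  simp only [outerCol, Set.mem_Icc, Prod.le_def]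
  grind

theorem preimage_swap_outerRow : Prod.swap ⁻¹' outerRow A.swap s m = outerCol A s m := by
  ext v
  rw [Set.mem_preimage, mem_outerRow, mem_outerCol]
  rfl

namespace HasLHandle

theorem mem_lShape_of_mem_cellVertices (h : HasLHandle A r s m n P) (hD : D ∈ P)
    (hv : v ∈ cellVertices D) (hA : v ∈ cellVertices A) : D ∈ lShape A r s := by
  have := h.two_le_r
  have := h.two_le_s
  rw [mem_cellVertices] at hA
  exact h.mem_lShape_of_mem hD hv (mem_vertexSet_lShape.mpr (by grind)) (by grind) (by grind)

theorem mem_lShape_of_mem_outerRow (h : HasLHandle A r s m n P) (hD : D ∈ P)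
    (hv : v ∈ cellVertices D) (hvA : v ∈ outerRow A r n) : D ∈ lShape A r s := by
  have := h.two_le_s
  have := h.n_eq
  rw [mem_outerRow] at hvA
  exact h.mem_lShape_of_mem hD hv (mem_vertexSet_lShape.mpr (by grind)) (by grind) (by grind)

theorem isFace_cellVertices (h : HasLHandle A r s m n P) : IsFace (IsMinor P) (cellVertices A) := by
  have hA : (cellVertices A : Set (ℤ × ℤ)) = Set.Icc (A.1, A.2) (A.1 + 1, A.2 + 1) := by
    ext v
    simp only [SetLike.mem_coe, mem_cellVertices, Set.mem_Icc, Prod.le_def]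
    grind
  rw [hA]
  refine isFace_isMinor_Icc (fun hD => ?_) (fun hD => ?_) (fun hD => ?_) (fun hD => ?_)
  · have := h.mem_lShape_of_mem_cellVertices (v := (A.1, A.2)) hD
    grind [mem_cellVertices, mem_lShape]
  · have := h.mem_lShape_of_mem_cellVertices (v := (A.1, A.2 + 1)) hD
    grind [mem_cellVertices, mem_lShape]
  · have := h.mem_lShape_of_mem_cellVertices (v := (A.1 + 1, A.2)) hD
    grind [mem_cellVertices, mem_lShape]
  · have := h.mem_lShape_of_mem_cellVertices (v := (A.1 + 1, A.2 + 1)) hD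
    grind [mem_cellVertices, mem_lShape]

theorem isFace_outerRow (h : HasLHandle A r s m n P) : IsFace (IsMinor P) (outerRow A r n) := by
  have hn := h.n_eq
  have hleft {y : ℤ} (hy : y = A.2 - n ∨ y = A.2 + 1 - n) : (A.1 - 1, y) ∉ P := fun hD => by
    have := h.mem_lShape_of_mem_outerRow (v := (A.1, A.2 + 1 - n)) hD
    grind [mem_cellVertices, mem_lShape, mem_outerRow]
  have hright {y : ℤ} (hy : y = A.2 - n ∨ y = A.2 + 1 - n) : (A.1 + r + 1, y) ∉ P := fun hD => by
    have := h.mem_lShape_of_mem_outerRow (v := (A.1 + r + 1, A.2 + 1 - n)) hD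
    grind [mem_cellVertices, mem_lShape, mem_outerRow]
  exact isFace_isMinor_Icc (hleft (by lia)) (hleft (by lia)) (hright (by lia)) (hright (by lia))

theorem isFace_outerCol (h : HasLHandle A r s m n P) : IsFace (IsMinor P) (outerCol A s m) := by
  intro a b c d hminor
  have := h.transpose.isFace_outerRow a.swap b.swap d.swap c.swap
    (isMinor_transpose.mpr (by simpa only [Prod.swap_swap] using hminor))
  simp only [← Set.mem_preimage, preimage_swap_outerRow] at this
  rw [this, or_comm]

theorem rightArm_disjoint_box (h : HasLHandle A r s m n P) (hminor : IsMinor P a b c d)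
    (ha : a ∉ outerRow A r n) (hb : b ∉ outerRow A r n) (hc : c ∉ outerRow A r n)
    (hd : d ∉ outerRow A r n) (hD : D ∈ box a b) (hDA : D.2 = A.2) :
    D.1 ≤ A.1 ∨ A.1 + r < D.1 := by
  obtain ⟨-, -, rfl, rfl, hP⟩ := hminor
  by_contra! hDr
  have := h.n_eq
  have hleft := h.mem_lShape_of_mem_outerRow (D := (A.1 - 1, A.2)) (v := (A.1, A.2 + 1 - n))
  have hacross := h.mem_lShape_of_mem_outerRow (D := (D.1, A.2 + 1 - 2 * n))
    (v := (D.1, A.2 + 1 - n))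
  have hP_left := @hP (A.1 - 1, A.2)
  have hP_across := @hP (D.1, A.2 + 1 - 2 * n)
  simp only [mem_box, mem_cellVertices, mem_lShape, mem_outerRow] at *
  grind

end HasLHandle

end Faces

section HilbertSeriesOuter

variable {K : Type*} [Field K] {A D : Cell} {r s : ℕ} {m n : ℤ} {P Q : Finset Cell}
  {a b c d v : ℤ × ℤ}

theorem IsMinor.mono (h : IsMinor P a b c d) (hPQ : P ⊆ Q) : IsMinor Q a b c d :=
  ⟨h.1, h.2.1, h.2.2.1, h.2.2.2.1, h.2.2.2.2.trans hPQ⟩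

theorem IsMinor.of_box_subset (h : IsMinor P a b c d) (hQ : box a b ⊆ Q) : IsMinor Q a b c d :=
  ⟨h.1, h.2.1, h.2.2.1, h.2.2.2.1, hQ⟩

theorem vertexSet_mono (h : P ⊆ Q) : vertexSet P ⊆ vertexSet Q :=
  Finset.biUnion_subset_biUnion_of_subset_left _ h

/-- The vertices of the horizontal arm on the edge line of the junction vertices, apart from these
and from the vertices of `A`. -/
noncomputable def innerRow (A : Cell) (r : ℕ) (n : ℤ) : Finset (ℤ × ℤ) :=
  Finset.Icc (A.1 + 2) (A.1 + r - 1) ×ˢ {A.2 + n}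

/-- The vertices of the vertical arm on the edge line of the junction vertices, apart from these
and from the vertices of `A`. -/
noncomputable def innerCol (A : Cell) (s : ℕ) (m : ℤ) : Finset (ℤ × ℤ) :=
  {A.1 + m} ×ˢ Finset.Icc (A.2 + 2) (A.2 + s - 1)

/-- The vertices of the L-shape that are neither junction vertices nor in `outerRow` or
`outerCol`. -/
noncomputable def innerVertices (A : Cell) (r s : ℕ) (m n : ℤ) : Finset (ℤ × ℤ) :=
  insert (A.1 + m, A.2 + n) (innerRow A r n ∪ innerCol A s m)

theorem mem_innerRow :
    v ∈ innerRow A r n ↔ v.2 = A.2 + n ∧ A.1 + 2 ≤ v.1 ∧ v.1 ≤ A.1 + r - 1 := by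
  rw [innerRow, Finset.mem_product, Finset.mem_Icc, Finset.mem_singleton, and_comm]

theorem mem_innerCol :
    v ∈ innerCol A s m ↔ v.1 = A.1 + m ∧ A.2 + 2 ≤ v.2 ∧ v.2 ≤ A.2 + s - 1 := by
  rw [innerCol, Finset.mem_product, Finset.mem_Icc, Finset.mem_singleton]

theorem mem_innerVertices : v ∈ innerVertices A r s m n ↔
    v.1 = A.1 + m ∧ v.2 = A.2 + n ∨ v ∈ innerRow A r n ∨ v ∈ innerCol A s m := by
  rw [innerVertices, Finset.mem_insert, Finset.mem_union, Prod.ext_iff]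

theorem card_innerRow : (innerRow A r n).card = r - 2 := by
  rw [innerRow, Finset.card_product, Int.card_Icc, Finset.card_singleton]
  lia

theorem card_innerCol : (innerCol A s m).card = s - 2 := by
  rw [innerCol, Finset.card_product, Int.card_Icc, Finset.card_singleton]
  lia

namespace HasLHandle

theorem card_innerVertices (h : HasLHandle A r s m n P) :
    (innerVertices A r s m n).card = r + s - 3 := by
  have := h.m_eq
  have := h.n_eq
  have := h.two_le_r
  have := h.two_le_s
  have hcorner : (A.1 + m, A.2 + n) ∉ innerRow A r n ∪ innerCol A s m := by
    rw [Finset.mem_union, mem_innerRow, mem_innerCol]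
    lia
  have hdisj : Disjoint (innerRow A r n) (innerCol A s m) := by
    refine Finset.disjoint_left.mpr fun v => ?_
    rw [mem_innerRow, mem_innerCol]
    lia
  rw [innerVertices, Finset.card_insert_of_notMem hcorner, Finset.card_union_of_disjoint hdisj,
    card_innerRow, card_innerCol]
  lia

theorem upArm_disjoint_box (h : HasLHandle A r s m n P) (hminor : IsMinor P a b c d)
    (ha : a ∉ outerCol A s m) (hb : b ∉ outerCol A s m) (hc : c ∉ outerCol A s m)
    (hd : d ∉ outerCol A s m) (hD : D ∈ box a b) (hDA : D.1 = A.1) :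
    D.2 ≤ A.2 ∨ A.2 + s < D.2 := by
  rw [← preimage_swap_outerRow] at ha hb hc hd
  have hswap : IsMinor (Polyomino.transpose P) a.swap b.swap d.swap c.swap :=
    isMinor_transpose.mpr (by simpa only [Prod.swap_swap] using hminor)
  exact h.transpose.rightArm_disjoint_box (D := D.swap) hswap ha hb hd hc
    (mem_box.mpr (mem_box.mp hD).symm) hDA

theorem left_below_notMem (h : HasLHandle A r s m n P) :
    (A.1 - 1, A.2) ∉ P ∧ (A.1, A.2 - 1) ∉ P := by
  constructor <;>
  · intro hD
    have := h.mem_lShape_of_mem_cellVertices (v := A) hD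
    grind [mem_cellVertices, mem_lShape]

theorem min_eq_of_mem_box (h : HasLHandle A r s m n P) (hminor : IsMinor P a b c d)
    (hA : A ∈ box a b) : min a.1 b.1 = A.1 ∧ min a.2 b.2 = A.2 := by
  have hleft := mt (@hminor.2.2.2.2 (A.1 - 1, A.2)) h.left_below_notMem.1
  have hbelow := mt (@hminor.2.2.2.2 (A.1, A.2 - 1)) h.left_below_notMem.2
  simp only [mem_box] at *
  grind

theorem isMinor_P₃ (h : HasLHandle A r s m n P) (hminor : IsMinor P a b c d)
    (ha : a ∉ outerRow A r n ∪ outerCol A s m) (hb : b ∉ outerRow A r n ∪ outerCol A s m)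
    (hc : c ∉ outerRow A r n ∪ outerCol A s m) (hd : d ∉ outerRow A r n ∪ outerCol A s m) :
    IsMinor (P₃ A r s P) a b c d := by
  simp only [Set.mem_union, not_or] at ha hb hc hd
  have hrow {D : Cell} := h.rightArm_disjoint_box (D := D) hminor ha.1 hb.1 hc.1 hd.1
  have hcol {D : Cell} := h.upArm_disjoint_box (D := D) hminor ha.2 hb.2 hc.2 hd.2
  have hA : A ∉ box a b := by
    intro hA
    obtain ⟨hx, hy⟩ := h.min_eq_of_mem_box hminor hA
    have hright := hrow (D := (A.1 + 1, A.2))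
    have hup := hcol (D := (A.1, A.2 + 1))
    obtain ⟨-, -, rfl, rfl, -⟩ := hminor
    have := h.two_le_r
    have := h.two_le_s
    have := h.m_eq
    have := h.n_eq
    simp only [mem_box, mem_outerRow] at *
    grind
  refine hminor.of_box_subset fun D hD => Finset.mem_sdiff.mpr ⟨hminor.2.2.2.2 hD, fun hL => ?_⟩
  have hDA : D ≠ A := fun hDA => hA (hDA ▸ hD)
  have := hrow hD
  have := hcol hD
  rw [← lShape, mem_lShape] at hL
  grind

theorem outer_union_inner_subset (h : HasLHandle A r s m n P) :
    outerRow A r n ∪ outerCol A s m ∪ innerVertices A r s m n ⊆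
      (vertexSet (lShape A r s) : Set (ℤ × ℤ)) := by
  intro v
  have := h.m_eq
  have := h.n_eq
  simp only [mem_vertexSet_lShape, Set.mem_union, mem_outerRow, mem_outerCol, SetLike.mem_coe,
    mem_innerVertices, mem_innerRow, mem_innerCol]
  lia

theorem mem_vertexSet_P₃_iff_of_mem_vertexSet_lShape (h : HasLHandle A r s m n P)
    (hv : v ∈ vertexSet (lShape A r s)) : v ∈ vertexSet (P₃ A r s P) ↔
      v ∉ outerRow A r n ∪ outerCol A s m ∪ innerVertices A r s m n := by
  refine (h.mem_vertexSet_sdiff_iff v hv).trans ?_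
  have := h.m_eq
  have := h.n_eq
  have := h.two_le_r
  have := h.two_le_s
  simp only [mem_vertexSet_lShape, Set.mem_union, mem_outerRow, mem_outerCol, SetLike.mem_coe,
    mem_innerVertices, mem_innerRow, mem_innerCol] at hv ⊢
  constructor <;> lia

theorem mem_vertexSet_P₃ (h : HasLHandle A r s m n P) : v ∈ vertexSet (P₃ A r s P) ↔
    v ∈ vertexSet P ∧ v ∉ outerRow A r n ∪ outerCol A s m ∪ innerVertices A r s m n := by
  have hunion : v ∈ vertexSet P ↔ v ∈ vertexSet (lShape A r s) ∨ v ∈ vertexSet (P₃ A r s P) := by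
    rw [← Finset.mem_union, vertexSet, vertexSet, vertexSet, ← Finset.union_biUnion, P₃, ← lShape,
      Finset.union_sdiff_of_subset h.lShape_subset]
  have hsub : v ∈ outerRow A r n ∪ outerCol A s m ∪ innerVertices A r s m n →
      v ∈ vertexSet (lShape A r s) := fun hv => h.outer_union_inner_subset hv
  have hL := h.mem_vertexSet_P₃_iff_of_mem_vertexSet_lShape (v := v)
  tauto

theorem hilbertSeries_minorIdeal_outerRow_union_outerCol (h : HasLHandle A r s m n P) :
    hilbertSeries (minorIdeal K P (outerRow A r n ∪ outerCol A s m)) =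
      ((1 - PowerSeries.X)⁻¹) ^ (r + s - 3) * HP K (P₃ A r s P) := by
  have hV (v : ℤ × ℤ) := h.mem_vertexSet_P₃ (v := v)
  have hFP : innerVertices A r s m n ⊆ vertexSet P := fun v hv =>
    vertexSet_mono h.lShape_subset (h.outer_union_inner_subset (Or.inr hv))
  rw [← h.card_innerVertices]
  refine (h.isFace_outerRow.union h.isFace_outerCol).hilbertSeries_minorIdeal_eq_pow_mul_HP
    (e := id) hFP (fun v hv => ?_) (fun a b c d hminor ha hb hc hd haF => ?_)
    Function.injective_id.injOn ?_ fun a ha b hb c hc d hd => ⟨fun hminor => ?_, fun hminor => ?_⟩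
  · have := h.m_eq
    have := h.n_eq
    simp only [Set.mem_union, mem_outerRow, mem_outerCol, mem_innerVertices, mem_innerRow,
      mem_innerCol] at hv ⊢
    lia
  · exact ((hV a).mp (h.isMinor_P₃ hminor ha hb hc hd).left_mem_vertexSet).2 (Or.inr haF)
  · ext v
    rw [Set.image_id, SetLike.mem_coe, hV, Set.mem_sdiff, SetLike.mem_coe]
  · exact hminor.mono Finset.sdiff_subset
  · have hZ {v : ℤ × ℤ} (hv : v ∈ vertexSet (P₃ A r s P)) : v ∉ outerRow A r n ∪ outerCol A s m :=
      fun hvZ => ((hV v).mp hv).2 (Or.inl hvZ)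
    exact h.isMinor_P₃ hminor (hZ ha) (hZ hb) (hZ hc) (hZ hd)

end HasLHandle

end HilbertSeriesOuter

section HilbertSeriesArms

variable {K : Type*} [Field K] {A D : Cell} {r s : ℕ} {m n : ℤ} {P : Finset Cell}
  {a b c d v : ℤ × ℤ}

theorem mem_P₁ : D ∈ P₁ A r P ↔ D ∈ P ∧ ¬(D.2 = A.2 ∧ A.1 ≤ D.1 ∧ D.1 ≤ A.1 + r) := by
  rw [P₁, Finset.mem_sdiff, mem_cellInterval_rightCell]

/-- Moves the lower edge of the cell above `A` to the line `y = A.2 + n`. For `n = 0` it thereby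
extends the inner intervals of `P₁` at this edge by the cell `A`. -/
noncomputable def shiftDown (A : Cell) (n : ℤ) (v : ℤ × ℤ) : ℤ × ℤ :=
  if v.2 = A.2 + 1 ∧ A.1 ≤ v.1 ∧ v.1 ≤ A.1 + 1 then (v.1, A.2 + n) else v

theorem shiftDown_of_mem (hv : v ∈ cellVertices A) (hy : v.2 = A.2 + 1) :
    shiftDown A n v = (v.1, A.2 + n) := by
  rw [mem_cellVertices] at hv
  exact if_pos ⟨hy, hv.1, hv.2.1⟩

theorem shiftDown_of_notMem (hv : v ∉ cellVertices A) : shiftDown A n v = v := by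
  rw [mem_cellVertices] at hv
  exact if_neg (by lia)

namespace HasLHandle

theorem mem_vertexSet_P₁ (h : HasLHandle A r s m n P) : v ∈ vertexSet (P₁ A r P) ↔
    A.1 ≤ v.1 ∧ v.1 ≤ A.1 + 1 ∧ A.2 + 1 ≤ v.2 ∧ v.2 ≤ A.2 + s + 1 ∨
      v ∈ vertexSet (P₃ A r s P) := by
  have := h.two_le_s
  constructor
  · simp only [mem_vertexSet, mem_P₁]
    rintro ⟨D, ⟨hD, hrow⟩, hv⟩
    by_cases hL : D ∈ lShape A r s
    · rw [mem_lShape] at hL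
      lia
    · exact Or.inr ⟨D, Finset.mem_sdiff.mpr ⟨hD, hL⟩, hv⟩
  · rintro (hv | hv)
    · have hL : (A.1, max (A.2 + 1) (v.2 - 1)) ∈ lShape A r s := mem_lShape.mpr (by grind)
      exact mem_vertexSet.mpr ⟨_, mem_P₁.mpr ⟨h.lShape_subset hL, by grind⟩, by grind⟩
    · exact vertexSet_mono (Finset.sdiff_subset_sdiff le_rfl Finset.subset_union_left) hv

theorem notMem_vertexSet_P₃ (h : HasLHandle A r s m n P) (hv : v ∈ cellVertices A) :
    v ∉ vertexSet (P₃ A r s P) := by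
  have := h.two_le_r
  have := h.two_le_s
  rw [mem_cellVertices] at hv
  have := h.mem_vertexSet_sdiff_iff v (mem_vertexSet_lShape.mpr (by grind))
  exact mt this.mp (by grind)

theorem injOn_shiftDown (h : HasLHandle A r s m n P) :
    Set.InjOn (shiftDown A n) (vertexSet (P₁ A r P)) := by
  intro v hv w hw hvw
  rw [SetLike.mem_coe, h.mem_vertexSet_P₁] at hv hw
  have := h.n_eq
  have hvA := h.notMem_vertexSet_P₃ (v := v)
  have hwA := h.notMem_vertexSet_P₃ (v := w)
  simp only [mem_cellVertices, shiftDown] at hvA hwA hvw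
  grind

theorem shiftDown_mem (h : HasLHandle A r s m n P) (hv : v ∈ vertexSet (P₁ A r P)) :
    shiftDown A n v ∈ vertexSet P ∧ shiftDown A n v ∉ outerRow A r n ∪ innerRow A r n := by
  rw [h.mem_vertexSet_P₁] at hv
  by_cases hvP₃ : v ∈ vertexSet (P₃ A r s P)
  · rw [shiftDown_of_notMem fun hvA => h.notMem_vertexSet_P₃ hvA hvP₃]
    rw [h.mem_vertexSet_P₃, Set.mem_union, Set.mem_union, SetLike.mem_coe,
      mem_innerVertices] at hvP₃
    rw [Set.mem_union, SetLike.mem_coe]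
    tauto
  · replace hv := hv.resolve_right hvP₃
    have := h.n_eq
    have := h.two_le_r
    have hL := @vertexSet_mono _ _ h.lShape_subset (shiftDown A n v)
    rw [mem_vertexSet_lShape] at hL
    rw [Set.mem_union, mem_outerRow, SetLike.mem_coe, mem_innerRow]
    by_cases hy : v.2 = A.2 + 1
    · rw [shiftDown_of_mem (mem_cellVertices.mpr (by lia)) hy] at hL ⊢
      exact ⟨hL (by grind), by lia⟩
    · rw [shiftDown_of_notMem (by rw [mem_cellVertices]; lia)] at hL ⊢
      exact ⟨hL (by lia), by lia⟩

theorem exists_shiftDown_eq (h : HasLHandle A r s m n P) (hv : v ∈ vertexSet P)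
    (hvZ : v ∉ outerRow A r n ∪ innerRow A r n) :
    ∃ w ∈ vertexSet (P₁ A r P), shiftDown A n w = v := by
  simp only [h.mem_vertexSet_P₁]
  by_cases hvP₃ : v ∈ vertexSet (P₃ A r s P)
  · exact ⟨v, Or.inr hvP₃, shiftDown_of_notMem fun hvA => h.notMem_vertexSet_P₃ hvA hvP₃⟩
  · have := h.m_eq
    have := h.n_eq
    simp only [h.mem_vertexSet_P₃, hv, true_and, not_not, Set.mem_union, SetLike.mem_coe,
      mem_innerVertices, mem_outerRow, mem_outerCol, mem_innerRow, mem_innerCol] at hvP₃ hvZ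
    have hs := h.two_le_s
    by_cases hy : v.2 ≤ A.2 + 1
    · refine ⟨(v.1, A.2 + 1), Or.inl (by grind), ?_⟩
      rw [shiftDown_of_mem (mem_cellVertices.mpr (by grind)) rfl]
      grind
    · exact ⟨v, Or.inl (by grind), shiftDown_of_notMem (by rw [mem_cellVertices]; lia)⟩

theorem image_shiftDown (h : HasLHandle A r s m n P) :
    shiftDown A n '' vertexSet (P₁ A r P) =
      (vertexSet P : Set (ℤ × ℤ)) \ (outerRow A r n ∪ innerRow A r n) := by
  ext v
  constructor
  · rintro ⟨w, hw, rfl⟩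
    exact h.shiftDown_mem hw
  · rintro ⟨hv, hvZ⟩
    exact h.exists_shiftDown_eq hv hvZ

theorem horizontal_edge_of_isMinor_P₁ (h : HasLHandle A r s m n P)
    (hminor : IsMinor (P₁ A r P) a b c d) (ha : a ∈ cellVertices A) :
    (a.1 = A.1 ∧ b.1 = A.1 + 1 ∨ a.1 = A.1 + 1 ∧ b.1 = A.1) ∧
      a.2 = A.2 + 1 ∧ A.2 + 2 ≤ b.2 := by
  have hcell {D : Cell} (hD : D ∈ box a b) {v : ℤ × ℤ} (hv : v ∈ cellVertices D)
      (hvA : v ∈ cellVertices A) : D = (A.1, A.2 + 1) := by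
    have hP := mem_P₁.mp (hminor.2.2.2.2 hD)
    have := h.mem_lShape_of_mem_cellVertices hP.1 hv hvA
    simp only [mem_cellVertices, mem_lShape] at *
    grind
  obtain ⟨D, hD, haD⟩ := hminor.exists_mem_box
  obtain rfl := hcell hD haD ha
  have hleft := hcell (D := (A.1 - 1, A.2 + 1)) (v := (A.1, A.2 + 1))
  have hright := hcell (D := (A.1 + 1, A.2 + 1)) (v := (A.1 + 1, A.2 + 1))
  have hbelow := hcell (D := A) (v := A)
  have := hminor.1
  simp only [mem_box, mem_cellVertices, Prod.ext_iff] at *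
  grind

theorem horizontal_edge_of_isMinor (h : HasLHandle A r s m n P) (hminor : IsMinor P a b c d)
    (ha : a ∉ outerRow A r n) (hb : b ∉ outerRow A r n) (hc : c ∉ outerRow A r n)
    (hd : d ∉ outerRow A r n) (haA : a ∈ cellVertices A) :
    (a.1 = A.1 ∧ b.1 = A.1 + 1 ∨ a.1 = A.1 + 1 ∧ b.1 = A.1) ∧
      a.2 = A.2 + n ∧ A.2 + 2 ≤ b.2 := by
  have hcell {D : Cell} (hD : D ∈ box a b) {v : ℤ × ℤ} (hv : v ∈ cellVertices D)
      (hvA : v ∈ cellVertices A) : D.1 = A.1 := by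
    have hL := h.mem_lShape_of_mem_cellVertices (hminor.2.2.2.2 hD) hv hvA
    have hright := h.rightArm_disjoint_box hminor ha hb hc hd hD
    rw [mem_lShape] at hL
    lia
  have hn := h.n_eq
  have hay : a.2 = A.2 + n := by
    rw [mem_outerRow] at ha
    rw [mem_cellVertices] at haA
    lia
  have hedge : (A.1, A.2 + n) ∈ box a b := by
    obtain ⟨D, hD, haD⟩ := hminor.exists_mem_box
    have hDx := hcell hD haD haA
    have hmin := h.min_eq_of_mem_box hminor
    have hDL := h.mem_lShape_of_mem_cellVertices (hminor.2.2.2.2 hD) haD haA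
    obtain ⟨-, -, rfl, -, -⟩ := hminor
    clear hcell
    simp only [mem_box, mem_cellVertices, mem_outerRow, mem_lShape] at *
    omega
  have hleft := hcell (D := (A.1 - 1, A.2 + n)) (v := (A.1, A.2 + 1))
  have hright := hcell (D := (A.1 + 1, A.2 + n)) (v := (A.1 + 1, A.2 + 1))
  have hmin := h.min_eq_of_mem_box hminor
  obtain ⟨h₁, h₂, rfl, rfl, -⟩ := hminor
  have hx : a.1 = A.1 ∧ b.1 = A.1 + 1 ∨ a.1 = A.1 + 1 ∧ b.1 = A.1 := by
    simp only [mem_box, mem_cellVertices] at *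
    grind
  refine ⟨hx, hay, ?_⟩
  simp only [mem_box, mem_cellVertices, mem_outerRow] at *
  grind

theorem isMinor_P₁_of_notMem_box (h : HasLHandle A r s m n P) (hminor : IsMinor P a b c d)
    (ha : a ∉ outerRow A r n) (hb : b ∉ outerRow A r n) (hc : c ∉ outerRow A r n)
    (hd : d ∉ outerRow A r n) (hA : A ∉ box a b) : IsMinor (P₁ A r P) a b c d := by
  refine hminor.of_box_subset fun D hD => mem_P₁.mpr ⟨hminor.2.2.2.2 hD, fun ⟨hy, hx, hxr⟩ => ?_⟩
  have hDx := (h.rightArm_disjoint_box hminor ha hb hc hd hD hy).resolve_right hxr.not_gt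
  exact hA ((Prod.ext (hDx.antisymm hx) hy : D = A) ▸ hD)

theorem notMem_innerRow_of_isMinor (h : HasLHandle A r s m n P) (hminor : IsMinor P a b c d)
    (ha : a ∉ outerRow A r n) (hb : b ∉ outerRow A r n) (hc : c ∉ outerRow A r n)
    (hd : d ∉ outerRow A r n) : a ∉ innerRow A r n := by
  intro haI
  obtain ⟨D, hD, haD⟩ := hminor.exists_mem_box
  have hn := h.n_eq
  have hs := h.two_le_s
  have hm := h.m_eq
  rw [mem_innerRow] at haI
  have hDL := h.mem_lShape_of_mem (hminor.2.2.2.2 hD) haD (mem_vertexSet_lShape.mpr (by lia))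
    (by lia) (by lia)
  have hright := h.rightArm_disjoint_box hminor ha hb hc hd hD
  rw [mem_cellVertices] at haD
  rw [mem_lShape] at hDL
  lia

theorem isMinor_shiftDown_left (h : HasLHandle A r s m n P) (hminor : IsMinor (P₁ A r P) a b c d)
    (ha : a ∈ cellVertices A) :
    IsMinor P (shiftDown A n a) (shiftDown A n b) (shiftDown A n c) (shiftDown A n d) := by
  obtain ⟨hx, hay, hby⟩ := h.horizontal_edge_of_isMinor_P₁ hminor ha
  obtain ⟨h₁, -, rfl, rfl, hP⟩ := hminor
  have hn := h.n_eq
  have hd : (b.1, a.2) ∈ cellVertices A := mem_cellVertices.mpr (by lia)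
  rw [shiftDown_of_mem ha hay, shiftDown_of_mem hd hay,
    shiftDown_of_notMem (v := b) (by rw [mem_cellVertices]; lia),
    shiftDown_of_notMem (v := (a.1, b.2)) (by rw [mem_cellVertices]; lia)]
  refine ⟨h₁, by lia, rfl, rfl, fun D hD => ?_⟩
  by_cases hDy : D.2 = A.2
  · refine h.lShape_subset (mem_lShape.mpr ?_)
    rw [mem_box] at hD
    omega
  · refine (mem_P₁.mp (hP ?_)).1
    rw [mem_box] at hD ⊢
    omega

theorem isMinor_P₁_of_shiftDown_left (h : HasLHandle A r s m n P) (ha : a ∈ vertexSet (P₁ A r P))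
    (hb : b ∈ vertexSet (P₁ A r P)) (hc : c ∈ vertexSet (P₁ A r P)) (hd : d ∈ vertexSet (P₁ A r P))
    (hminor : IsMinor P (shiftDown A n a) (shiftDown A n b) (shiftDown A n c) (shiftDown A n d))
    (haA : a ∈ cellVertices A) : IsMinor (P₁ A r P) a b c d := by
  have hZ {v : ℤ × ℤ} (hv : v ∈ vertexSet (P₁ A r P)) : shiftDown A n v ∉ outerRow A r n :=
    fun hvZ => (h.shiftDown_mem hv).2 (Or.inl hvZ)
  have hy {v : ℤ × ℤ} (hv : v ∈ vertexSet (P₁ A r P)) (hvA : v ∈ cellVertices A) :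
      v.2 = A.2 + 1 := by
    have hcol := (h.mem_vertexSet_P₁.mp hv).resolve_right (h.notMem_vertexSet_P₃ hvA)
    rw [mem_cellVertices] at hvA
    lia
  have hfix {v : ℤ × ℤ} (hv : v ∈ vertexSet (P₁ A r P)) (hvy : A.2 + 2 ≤ (shiftDown A n v).2) :
      shiftDown A n v = v := by
    refine shiftDown_of_notMem fun hvA => ?_
    rw [shiftDown_of_mem hvA (hy hv hvA)] at hvy
    have := h.n_eq
    lia
  have hay := hy ha haA
  rw [shiftDown_of_mem haA hay] at hminor
  have hn := h.n_eq
  have hedge_a := h.horizontal_edge_of_isMinor hminor (shiftDown_of_mem haA hay ▸ hZ ha) (hZ hb)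
    (hZ hc) (hZ hd) (by rw [mem_cellVertices] at haA ⊢; lia)
  obtain ⟨h₁, -, hc_eq, hd_eq, hP⟩ := hminor
  rw [hfix hc (by rw [hc_eq]; exact hedge_a.2.2)] at hc_eq
  rw [hfix hb hedge_a.2.2] at h₁ hc_eq hd_eq hP hedge_a
  have hdA : d ∈ cellVertices A := by
    by_contra hdA
    rw [shiftDown_of_notMem hdA] at hd_eq
    refine hdA (hd_eq ▸ mem_cellVertices.mpr ?_)
    lia
  have hdx := congrArg Prod.fst hd_eq
  rw [shiftDown_of_mem hdA (hy hd hdA)] at hdx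
  refine ⟨h₁, by lia, hc_eq, Prod.ext hdx ((hy hd hdA).trans hay.symm), fun D hD => ?_⟩
  rw [mem_box] at hD
  refine mem_P₁.mpr ⟨hP (mem_box.mpr ?_), ?_⟩
  · dsimp only
    omega
  · omega

theorem isMinor_P₁_iff_shiftDown (h : HasLHandle A r s m n P) (ha : a ∈ vertexSet (P₁ A r P))
    (hb : b ∈ vertexSet (P₁ A r P)) (hc : c ∈ vertexSet (P₁ A r P))
    (hd : d ∈ vertexSet (P₁ A r P)) : IsMinor (P₁ A r P) a b c d ↔
      IsMinor P (shiftDown A n a) (shiftDown A n b) (shiftDown A n c) (shiftDown A n d) := by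
  by_cases haA : a ∈ cellVertices A
  · exact ⟨fun hm => h.isMinor_shiftDown_left hm haA,
      fun hm => h.isMinor_P₁_of_shiftDown_left ha hb hc hd hm haA⟩
  by_cases hbA : b ∈ cellVertices A
  · exact ⟨fun hm => (h.isMinor_shiftDown_left hm.swap hbA).swap,
      fun hm => (h.isMinor_P₁_of_shiftDown_left hb ha hd hc hm.swap hbA).swap⟩
  by_cases hcA : c ∈ cellVertices A
  · exact ⟨fun hm => (h.isMinor_shiftDown_left hm.flip hcA).flip,
      fun hm => (h.isMinor_P₁_of_shiftDown_left hc hd ha hb hm.flip hcA).flip⟩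
  by_cases hdA : d ∈ cellVertices A
  · exact ⟨fun hm => (h.isMinor_shiftDown_left hm.flip.swap hdA).swap.flip,
      fun hm => (h.isMinor_P₁_of_shiftDown_left hd hc hb ha hm.flip.swap hdA).swap.flip⟩
  have hZ {v : ℤ × ℤ} (hv : v ∈ vertexSet (P₁ A r P)) (hvA : v ∉ cellVertices A) :
      v ∉ outerRow A r n := fun hvZ =>
    (h.shiftDown_mem hv).2 (Or.inl (by rwa [shiftDown_of_notMem hvA]))
  rw [shiftDown_of_notMem haA, shiftDown_of_notMem hbA, shiftDown_of_notMem hcA,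
    shiftDown_of_notMem hdA]
  refine ⟨fun hm => hm.mono Finset.sdiff_subset, fun hm =>
    h.isMinor_P₁_of_notMem_box hm (hZ ha haA) (hZ hb hbA) (hZ hc hcA) (hZ hd hdA) fun hA => ?_⟩
  have hmin := h.min_eq_of_mem_box hm hA
  obtain ⟨-, -, rfl, rfl, -⟩ := hm
  simp only [mem_cellVertices] at haA hbA hcA hdA
  omega

theorem hilbertSeries_minorIdeal_outerRow (h : HasLHandle A r s m n P) :
    hilbertSeries (minorIdeal K P (outerRow A r n)) =
      ((1 - PowerSeries.X)⁻¹) ^ (r - 2) * HP K (P₁ A r P) := by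
  rw [← card_innerRow (A := A) (n := n)]
  refine h.isFace_outerRow.hilbertSeries_minorIdeal_eq_pow_mul_HP (fun v hv => ?_)
    (fun v hv => ?_) (fun a b c d hm ha hb hc hd => h.notMem_innerRow_of_isMinor hm ha hb hc hd)
    h.injOn_shiftDown h.image_shiftDown
    fun a ha b hb c hc d hd => h.isMinor_P₁_iff_shiftDown ha hb hc hd
  · have hinner : v ∈ innerVertices A r s m n := mem_innerVertices.mpr (Or.inr (Or.inl hv))
    exact vertexSet_mono h.lShape_subset (h.outer_union_inner_subset (Or.inr hinner))
  · have := h.n_eq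
    rw [mem_innerRow] at hv
    rw [mem_outerRow]
    lia

theorem hilbertSeries_minorIdeal_outerCol (h : HasLHandle A r s m n P) :
    hilbertSeries (minorIdeal K P (outerCol A s m)) =
      ((1 - PowerSeries.X)⁻¹) ^ (s - 2) * HP K (P₂ A s P) := by
  have hP₂ : P₁ A.swap s (Polyomino.transpose P) = Polyomino.transpose (P₂ A s P) := by
    ext D
    rw [mem_P₁, mem_transpose, mem_transpose, P₂, Finset.mem_sdiff, mem_cellInterval_upCell]
    rfl
  rw [← preimage_swap_outerRow, ← hilbertSeries_minorIdeal_transpose,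
    h.transpose.hilbertSeries_minorIdeal_outerRow, hP₂, HP_transpose]

end HasLHandle

end HilbertSeriesArms

section HilbertSeriesMain

variable {K : Type*} [Field K] {A D : Cell} {r s : ℕ} {m n : ℤ} {P : Finset Cell}
  {a b c d v : ℤ × ℤ}

theorem mem_P₄ : D ∈ P₄ A P ↔
    D ∈ P ∧ ¬(D.2 = A.2 ∧ A.1 ≤ D.1 ∧ D.1 ≤ A.1 + 1 ∨ D.1 = A.1 ∧ D.2 = A.2 + 1) := by
  simp only [P₄, rightCell, upCell, Finset.mem_sdiff, Finset.mem_insert, Finset.mem_singleton,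
    Prod.ext_iff, Prod.fst_add, Prod.snd_add]
  grind

namespace HasLHandle

theorem mem_vertexSet_P₄ (h : HasLHandle A r s m n P) :
    v ∈ vertexSet (P₄ A P) ↔ v ∈ vertexSet P ∧ v ∉ cellVertices A := by
  have hr := h.two_le_r
  have hs := h.two_le_s
  constructor
  · intro hv
    refine ⟨vertexSet_mono Finset.sdiff_subset hv, fun hvA => ?_⟩
    obtain ⟨D, hD, hvD⟩ := Finset.mem_biUnion.mp hv
    rw [mem_P₄] at hD
    have hDL := h.mem_lShape_of_mem_cellVertices hD.1 hvD hvA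
    rw [mem_lShape] at hDL
    rw [mem_cellVertices] at hvD hvA
    lia
  · rintro ⟨hv, hvA⟩
    obtain ⟨D, hD, hvD⟩ := Finset.mem_biUnion.mp hv
    rw [mem_cellVertices] at hvA hvD
    by_cases hD₄ : D ∈ P₄ A P
    · exact mem_vertexSet.mpr ⟨D, hD₄, hvD⟩
    have hA₂ : (A.1 + 2, A.2) ∈ P₄ A P :=
      mem_P₄.mpr ⟨h.lShape_subset (mem_lShape.mpr (by grind)), by lia⟩
    have hB₂ : (A.1, A.2 + 2) ∈ P₄ A P :=
      mem_P₄.mpr ⟨h.lShape_subset (mem_lShape.mpr (by grind)), by lia⟩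
    rw [mem_P₄] at hD₄
    by_cases hvx : v.1 = A.1 + 2
    · exact mem_vertexSet.mpr ⟨_, hA₂, by lia⟩
    · exact mem_vertexSet.mpr ⟨_, hB₂, by lia⟩

theorem isMinor_P₄ (h : HasLHandle A r s m n P) (hminor : IsMinor P a b c d)
    (ha : a ∉ cellVertices A) (hb : b ∉ cellVertices A) (hc : c ∉ cellVertices A)
    (hd : d ∉ cellVertices A) : IsMinor (P₄ A P) a b c d := by
  have hright : (A.1 + 1, A.2 - 1) ∉ P := fun hD => by
    have := h.mem_lShape_of_mem_cellVertices (v := (A.1 + 1, A.2)) hD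
    grind [mem_cellVertices, mem_lShape]
  have hup : (A.1 - 1, A.2 + 1) ∉ P := fun hD => by
    have := h.mem_lShape_of_mem_cellVertices (v := (A.1, A.2 + 1)) hD
    grind [mem_cellVertices, mem_lShape]
  have hright_box := mt (@hminor.2.2.2.2 _) hright
  have hup_box := mt (@hminor.2.2.2.2 _) hup
  have hmin := h.min_eq_of_mem_box hminor
  refine hminor.of_box_subset fun D hD => mem_P₄.mpr ⟨hminor.2.2.2.2 hD, ?_⟩
  obtain ⟨-, -, rfl, rfl, -⟩ := hminor
  simp only [mem_cellVertices, mem_box] at *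
  omega

theorem hilbertSeries_minorIdeal_cellVertices (h : HasLHandle A r s m n P) :
    hilbertSeries (minorIdeal K P (cellVertices A)) = HP K (P₄ A P) := by
  have key := h.isFace_cellVertices.hilbertSeries_minorIdeal_eq_pow_mul_HP (K := K) (F := ∅)
    (Q := P₄ A P) (e := id) (Finset.empty_subset _) (fun v hv => (Finset.notMem_empty v hv).elim)
    (fun a _ _ _ _ _ _ _ _ => Finset.notMem_empty a) Function.injective_id.injOn ?_
    fun a ha b hb c hc d hd => ⟨fun hm => hm.mono Finset.sdiff_subset, fun hm => ?_⟩
  · rwa [Finset.card_empty, pow_zero, one_mul] at key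
  · ext v
    simp only [Set.image_id, Finset.coe_empty, Set.union_empty, Set.mem_sdiff, SetLike.mem_coe,
      h.mem_vertexSet_P₄]
  · exact h.isMinor_P₄ hm (h.mem_vertexSet_P₄.mp ha).2 (h.mem_vertexSet_P₄.mp hb).2
      (h.mem_vertexSet_P₄.mp hc).2 (h.mem_vertexSet_P₄.mp hd).2

theorem cellVertices_eq (h : HasLHandle A r s m n P) : (cellVertices A : Set (ℤ × ℤ)) =
    {(A.1 + m, A.2 + n), (A.1 + m, A.2 + 1 - n), (A.1 + 1 - m, A.2 + n),
      (A.1 + 1 - m, A.2 + 1 - n)} := by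
  have := h.m_eq
  have := h.n_eq
  ext v
  simp only [SetLike.mem_coe, mem_cellVertices, Set.mem_insert_iff, Set.mem_singleton_iff,
    Prod.ext_iff]
  lia

theorem cellVertices_subset (h : HasLHandle A r s m n P) : cellVertices A ⊆ vertexSet P :=
  Finset.subset_biUnion_of_mem _ (h.lShape_subset (mem_lShape.mpr (by lia)))

theorem box_subset_lShape (h : HasLHandle A r s m n P) (hv : v ∈ cellVertices A) {z : ℤ × ℤ}
    (hz : z ∈ outerRow A r n ∪ outerCol A s m) : box v z ⊆ lShape A r s := by
  intro D hD
  have := h.m_eq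
  have := h.n_eq
  rw [Set.mem_union, mem_outerRow, mem_outerCol] at hz
  rw [mem_cellVertices] at hv
  rw [mem_box] at hD
  rw [mem_lShape]
  omega

theorem hilbertSeries_minorIdeal_insert (h : HasLHandle A r s m n P) {Y Z : Set (ℤ × ℤ)}
    (hA : ∀ v : vertexSet P, (v : ℤ × ℤ) ∈ cellVertices A →
      ∀ f, X v * f ∈ minorIdeal K P ∅ → f ∈ minorIdeal K P ∅)
    (hZ : IsFace (IsMinor P) Z) (hZ_outer : Z ⊆ outerRow A r n ∪ outerCol A s m) (hYZ : Y ⊆ Z)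
    (hv : v ∈ cellVertices A) (hvZ : v ∉ Z)
    (hcorner : ∀ z ∈ Z, (v.1, z.2) ∈ Y ∨ (z.1, v.2) ∈ Y) :
    hilbertSeries (minorIdeal K P Y) = hilbertSeries (minorIdeal K P (insert v Y)) +
      PowerSeries.X * hilbertSeries (minorIdeal K P Z) :=
  hZ.hilbertSeries_minorIdeal hYZ ⟨v, h.cellVertices_subset hv⟩ hvZ
    (fun z hz => X_mul_X_mem_minorIdeal
      ((h.box_subset_lShape hv (hZ_outer hz)).trans h.lShape_subset) (hcorner z hz)) (hA _ hv)

theorem mk_notMem_outerRow (h : HasLHandle A r s m n P) {x : ℤ} :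
    (x, A.2 + n) ∉ outerRow A r n := by
  have := h.n_eq
  rw [mem_outerRow]
  lia

theorem mk_notMem_outerCol (h : HasLHandle A r s m n P) {y : ℤ} :
    (A.1 + m, y) ∉ outerCol A s m := by
  have := h.m_eq
  rw [mem_outerCol]
  lia

theorem HP_eq (h : HasLHandle A r s m n P)
    (hA : ∀ v : vertexSet P, (v : ℤ × ℤ) ∈ cellVertices A →
      ∀ f, X v * f ∈ polyominoIdeal K P → f ∈ polyominoIdeal K P) :
    HP K P = (1 - PowerSeries.X)⁻¹ * (HP K (P₄ A P) +
      PowerSeries.X * hilbertSeries (minorIdeal K P (outerRow A r n ∪ outerCol A s m)) +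
      PowerSeries.X * hilbertSeries (minorIdeal K P (outerCol A s m)) +
      PowerSeries.X * hilbertSeries (minorIdeal K P (outerRow A r n))) := by
  rw [polyominoIdeal_eq_minorIdeal] at hA
  have hm := h.m_eq
  have hn := h.n_eq
  have hcells := h.cellVertices_eq
  set x := A.1 + m
  set y := A.2 + n
  set x' := A.1 + 1 - m
  set y' := A.2 + 1 - n
  have hcorner : (x, y) ∈ cellVertices A ∧ (x, y') ∈ cellVertices A ∧ (x', y) ∈ cellVertices A ∧
      (x', y') ∈ cellVertices A := by
    simp only [← SetLike.mem_coe, hcells, Set.mem_insert_iff, Set.mem_singleton_iff, true_or,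
      or_true, and_self]
  have hrow : (x', y') ∈ outerRow A r n ∧ (x, y') ∈ outerRow A r n := by
    simp only [mem_outerRow]
    lia
  have hcol : (x', y') ∈ outerCol A s m ∧ (x', y) ∈ outerCol A s m := by
    simp only [mem_outerCol]
    lia
  have hrow_y {z : ℤ × ℤ} (hz : z ∈ outerRow A r n) : z.2 = y' := (mem_outerRow.mp hz).1
  have hcol_x {z : ℤ × ℤ} (hz : z ∈ outerCol A s m) : z.1 = x' := (mem_outerCol.mp hz).1
  have hinsert_row := h.hilbertSeries_minorIdeal_insert hA (Y := {(x', y')}) h.isFace_outerRow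
    Set.subset_union_left (Set.singleton_subset_iff.mpr hrow.1) hcorner.2.2.1
    h.mk_notMem_outerRow fun z hz => Or.inl (hrow_y hz ▸ rfl)
  have hinsert_col := h.hilbertSeries_minorIdeal_insert hA (Y := {(x', y), (x', y')})
    h.isFace_outerCol
    Set.subset_union_right (Set.pair_subset hcol.2 hcol.1) hcorner.2.1
    h.mk_notMem_outerCol fun z hz => Or.inr (hcol_x hz ▸ Or.inr rfl)
  have hinsert_both := h.hilbertSeries_minorIdeal_insert hA (Y := {(x, y'), (x', y), (x', y')})
    (h.isFace_outerRow.union h.isFace_outerCol) subset_rfl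
    (Set.insert_subset (Or.inl hrow.2) (Set.pair_subset (Or.inr hcol.2) (Or.inr hcol.1)))
    hcorner.1 (not_or.mpr ⟨h.mk_notMem_outerRow, h.mk_notMem_outerCol⟩)
    fun z hz => hz.imp (fun hz => hrow_y hz ▸ Or.inl rfl) fun hz => hcol_x hz ▸ Or.inr (Or.inl rfl)
  rw [HP_eq_hilbertSeries, hilbertSeries_minorIdeal_empty ⟨_, h.cellVertices_subset hcorner.2.2.2⟩
    (hA _ hcorner.2.2.2), hinsert_row, hinsert_col, hinsert_both, ← hcells,
    h.hilbertSeries_minorIdeal_cellVertices]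

end HasLHandle

end HilbertSeriesMain

end Polyomino

theorem mainTheorem4_general {K : Type*} [Field K] (A : Polyomino.Cell) {r s : ℕ} (hr : 2 ≤ r)
    (hs : 2 ≤ s) {P : Finset Polyomino.Cell} (hL : Polyomino.lShape A r s ⊆ P) {i : Fin 4}
    (hi : Polyomino.vertexSet (Polyomino.lShape A r s) ∩
      Polyomino.vertexSet (P \ Polyomino.lShape A r s) = Polyomino.junction A r s i)
    (hA : ∀ v : Polyomino.vertexSet P, (v : ℤ × ℤ) ∈ Polyomino.cellVertices A →
      ∀ f, MvPolynomial.X v * f ∈ Polyomino.polyominoIdeal K P → f ∈ Polyomino.polyominoIdeal K P) :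
    Polyomino.HP K P =
      (1 - PowerSeries.X)⁻¹ * Polyomino.HP K (Polyomino.P₄ A P) +
        PowerSeries.X * (1 - PowerSeries.X)⁻¹ *
          (((1 - PowerSeries.X)⁻¹) ^ (r - 2) * Polyomino.HP K (Polyomino.P₁ A r P) +
            ((1 - PowerSeries.X)⁻¹) ^ (s - 2) * Polyomino.HP K (Polyomino.P₂ A s P) +
            ((1 - PowerSeries.X)⁻¹) ^ (r + s - 3) * Polyomino.HP K (Polyomino.P₃ A r s P)) := by
  obtain ⟨m, n, h⟩ := Polyomino.exists_hasLHandle hr hs hL hi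
  rw [h.HP_eq hA, h.hilbertSeries_minorIdeal_outerRow, h.hilbertSeries_minorIdeal_outerCol,
    h.hilbertSeries_minorIdeal_outerRow_union_outerCol]
  ring

theorem mainTheorem4 {K : Type*} [Field K] (A : Polyomino.Cell) (r s : ℕ)
    (C P : Finset Polyomino.Cell) (hP : Polyomino.IsLCPolyomino A r s C P)
    (hprime : (Polyomino.polyominoIdeal K P).IsPrime) :
    Polyomino.HP K P =
      (1 - PowerSeries.X)⁻¹ * Polyomino.HP K (Polyomino.P₄ A P) +
        PowerSeries.X * (1 - PowerSeries.X)⁻¹ *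
          (((1 - PowerSeries.X)⁻¹) ^ (r - 2) * Polyomino.HP K (Polyomino.P₁ A r P) +
            ((1 - PowerSeries.X)⁻¹) ^ (s - 2) * Polyomino.HP K (Polyomino.P₂ A s P) +
            ((1 - PowerSeries.X)⁻¹) ^ (r + s - 3) * Polyomino.HP K (Polyomino.P₃ A r s P)) := by
  obtain ⟨i, hi, -⟩ := hP.junction_eq
  have hC : P \ Polyomino.lShape A r s = C := by
    rw [hP.eq_union, Finset.union_sdiff_cancel_left hP.disjoint]
  exact mainTheorem4_general A hP.two_le_r hP.two_le_s
    (hP.eq_union ▸ Finset.subset_union_left) (hC.symm ▸ hi)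
    fun v _ _ hf => (hprime.mem_or_mem hf).resolve_left (Polyomino.X_notMem_polyominoIdeal v)
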